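/- For a finite group $G$ let $\widehat G$ be the set of equivalence classes of irreducible unitary representations of $G$, let $\mu_G(\{\Lambda\})=(\dim\Lambda)^2/|G|$ be the Plancherel measure on $\widehat G$, and let $\widetilde\mu_G$ be its image under $\Lambda\mapsto\dim\Lambda$, regarded as a probability measure on the one-point compactification $\{1,2,\dots\}\cup\{\infty\}$. For $x\colon G\to\mathbb C$ let $P_x=[x(hg^{-1})]_{h,g\in G}$ be the matrix of the convolution operator $v\mapsto x*v$ on $\mathbb C^G$. A complex random variable is standard complex Gaussian if its real and imaginary parts are independent real Gaussian variables of mean $0$ and variance $1/2$. In a $C^*$-probability space $(\mathcal A,\varphi)$ (a unital $C^*$-algebra with a state), unital subalgebras $(\mathcal A_i)$ are free if $\varphi(a_1\cdots a_n)=0$ whenever $n\ge1$, $a_k\in\mathcal A_{i_k}$, $\varphi(a_k)=0$ for all $k$, and $i_k\ne i_{k+1}$ for $k<n$; subsets are free if the unital subalgebras they generate are. A semicircular element is a self-adjoint $a$ with $\varphi(a^{2n+1})=0$ and $\varphi(a^{2n})=\frac1{n+1}\binom{2n}{n}$ for all $n\ge0$. A circular element is one of the form $c=(a+\sqrt{-1}\,b)/\sqrt2$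 with $a,b$ free semicircular elements. Proposition 4. Let $G_N$ be finite groups with $|G_N|\to\infty$ such that $\widetilde\mu_{G_N}$ converges weakly to $\delta_\infty$. For each $N$ let $X^{N,i}_g$ ($1\le i\le m$, $g\in G_N$) be independent standard complex Gaussian variables. Then the matrices $|G_N|^{-1/2}P_{X^{N,i}}$, $i\le m$, with their adjoints converge in moments to $(c_1,c_1^*,\dots,c_m,c_m^*)$, where $c_1,\dots,c_m$ are circular elements of a $C^*$-probability space such that $\{c_1,c_1^*\},\dots,\{c_m,c_m^*\}$ are free. That is: such families $c_1,\dots,c_m$ exist, and for every such family, in any $C^*$-probability space $(\mathcal A,\varphi)$, and every noncommutative polynomial $Q$ in $2m$ variables, $$\frac1{|G_N|}\,\mathbb E\operatorname{tr}Q\bigl(|G_N|^{-1/2}P_{X^{N,1}},|G_N|^{-1/2}P_{X^{N,1}}^*,\dots,|G_N|^{-1/2}P_{X^{N,m}},|G_N|^{-1/2}P_{X^{N,m}}^*\bigr)\longrightarrow\varphi\bigl(Q(c_1,c_1^*,\dots,c_m,c_m^*)\bigr)$$ as $N\to\infty$, where all the expectations on the left exist. -/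

import Mathlib

open MeasureTheory ProbabilityTheory Filter Topology

noncomputable section

namespace RandomConvolution

/-! ### The unitary dual of a finite group and its Plancherel measure -/

/-- An `n`-dimensional unitary representation of `G`, as a linear representation on `ℂⁿ`. -/
def unitaryToRep {G : Type*} [Group G] {n : ℕ}
    (ρ : G →* Matrix.unitaryGroup (Fin n) ℂ) : Representation ℂ G (Fin n → ℂ) :=
  ((Matrix.toLinAlgEquiv' : Matrix (Fin n) (Fin n) ℂ ≃ₐ[ℂ] ((Fin n → ℂ) →ₗ[ℂ] (Fin n → ℂ))) :
      Matrix (Fin n) (Fin n) ℂ →* ((Fin n → ℂ) →ₗ[ℂ] (Fin n → ℂ))).comp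
    ((Submonoid.subtype _).comp ρ)

/-- The irreducible `n`-dimensional unitary representations of `G`. -/
def IrrepOfDim (G : Type*) [Group G] (n : ℕ) : Type _ :=
  {ρ : G →* Matrix.unitaryGroup (Fin n) ℂ // (unitaryToRep ρ).IsIrreducible}

/-- Equivalence (isomorphism) of representations. -/
instance irrepSetoid (G : Type*) [Group G] (n : ℕ) : Setoid (IrrepOfDim G n) where
  r ρ σ := Nonempty ((unitaryToRep ρ.1).Equiv (unitaryToRep σ.1))
  iseqv :=
    { refl := fun _ => ⟨Representation.Equiv.refl _⟩
      symm := fun ⟨e⟩ => ⟨e.symm⟩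
      trans := fun ⟨e⟩ ⟨f⟩ => ⟨e.trans f⟩ }

/-- The set of equivalence classes of irreducible unitary representations of the finite group `G`
(all of which are of finite positive dimension). -/
def UnitaryDual (G : Type*) [Group G] : Type _ :=
  Σ n : ℕ+, Quotient (irrepSetoid G (n : ℕ))

/-- The dimension of (a class of) irreducible representations. -/
def UnitaryDual.dim {G : Type*} [Group G] (Λ : UnitaryDual G) : ℕ+ := Λ.1

instance (G : Type*) [Group G] : MeasurableSpace (UnitaryDual G) := ⊤

/-- The Plancherel measure: the class `Λ` has mass `(dim Λ)² / |G|`. -/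
def plancherel (G : Type*) [Group G] [Fintype G] : Measure (UnitaryDual G) :=
  Measure.sum fun Λ : UnitaryDual G =>
    (((Λ.dim : ℕ) : ENNReal) ^ 2 / (Fintype.card G : ENNReal)) • Measure.dirac Λ

/-- The one-point compactification `{1, 2, …} ∪ {∞}` carries its Borel σ-algebra. -/
instance : MeasurableSpace (OnePoint ℕ+) := borel _

instance : BorelSpace (OnePoint ℕ+) := ⟨rfl⟩

/-- The image of the Plancherel measure under `Λ ↦ dim Λ`, as a measure on `{1, 2, …} ∪ {∞}`. -/
def plancherelDim (G : Type*) [Group G] [Fintype G] : Measure (OnePoint ℕ+) :=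
  (plancherel G).map fun Λ => ((Λ.dim : ℕ+) : OnePoint ℕ+)

/-- Weak convergence of (probability) measures: convergence of the integrals of all bounded
continuous functions. -/
def WeaklyConverges {E : Type*} [TopologicalSpace E] [MeasurableSpace E]
    (μs : ℕ → Measure E) (μ : Measure E) : Prop :=
  ∀ f : BoundedContinuousFunction E ℝ,
    Tendsto (fun N => ∫ x, f x ∂(μs N)) atTop (𝓝 (∫ x, f x ∂μ))

/-! ### Convolution operators and Gaussian variables -/

/-- The matrix `[x (h g⁻¹)]` of the convolution operator `v ↦ x ∗ v` on `ℂ^G`. -/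
def convMatrix {G : Type*} [Group G] (x : G → ℂ) : Matrix G G ℂ :=
  Matrix.of fun h g => x (h * g⁻¹)

/-- The matrix acts as convolution by `x`. -/
theorem convMatrix_mulVec {G : Type*} [Group G] [Fintype G] (x v : G → ℂ) (h : G) :
    (convMatrix x).mulVec v h = ∑ g, x (h * g⁻¹) * v g := rfl

/-- `Z` is a standard complex Gaussian variable: its real and imaginary parts are independent
real Gaussian variables of mean zero and variance `1/2`. -/
structure IsStdComplexGaussian {Ω : Type*} [MeasurableSpace Ω] (Z : Ω → ℂ) (P : Measure Ω) :
    Prop where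
  re_law : HasLaw (fun ω => (Z ω).re) (gaussianReal 0 (1 / 2)) P
  im_law : HasLaw (fun ω => (Z ω).im) (gaussianReal 0 (1 / 2)) P
  indep : IndepFun (fun ω => (Z ω).re) (fun ω => (Z ω).im) P

/-- The normalized random matrix `|G|^{-1/2} P_X`, a matrix-valued random variable. -/
def normConv {G Ω : Type*} [Group G] [Fintype G] (X : G → Ω → ℂ) : Ω → Matrix G G ℂ :=
  fun ω => (((Real.sqrt (Fintype.card G))⁻¹ : ℝ) : ℂ) • convMatrix fun g => X g ω

/-- The functional `(1/n) E tr` on `n × n` random matrices. -/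
def meanTrace {ι Ω : Type*} [Fintype ι] [MeasurableSpace Ω] (P : Measure Ω)
    (M : Ω → Matrix ι ι ℂ) : ℂ :=
  (Fintype.card ι : ℂ)⁻¹ * ∫ ω, (M ω).trace ∂P

/-! ### Noncommutative probability -/

/-- A state on a unital C⋆-algebra. -/
structure IsState {A : Type*} [CStarAlgebra A] (φ : A →ₗ[ℂ] ℂ) : Prop where
  map_one : φ 1 = 1
  map_star : ∀ a, φ (star a) = star (φ a)
  nonneg : ∀ a, 0 ≤ (φ (a * star a)).re

/-- The distribution of a family `a` with respect to the functional `φ`: it sends the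
noncommutative polynomial `Q` to `φ (Q (a))`. -/
def ncDistribution {A ι : Type*} [Ring A] [Algebra ℂ A] (φ : A → ℂ) (a : ι → A) :
    FreeAlgebra ℂ ι → ℂ :=
  fun Q => φ (FreeAlgebra.lift ℂ a Q)

/-- The family consisting of the elements `a i` and of their adjoints. -/
def withAdjoints {A ι : Type*} [Star A] (a : ι → A) : ι ⊕ ι → A :=
  Sum.elim a fun i => star (a i)

/-- Freeness of a family of subalgebras: alternating products of centred elements are centred. -/
def FreeSubalgebras {A ι : Type*} [Ring A] [Algebra ℂ A] (φ : A →ₗ[ℂ] ℂ)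
    (S : ι → Subalgebra ℂ A) : Prop :=
  ∀ (n : ℕ) (i : Fin (n + 1) → ι) (a : Fin (n + 1) → A),
    (∀ k : Fin n, i k.castSucc ≠ i k.succ) → (∀ k, a k ∈ S (i k)) → (∀ k, φ (a k) = 0) →
      φ (List.ofFn a).prod = 0

/-- Freeness of a family of subsets: freeness of the unital subalgebras they generate. -/
def FreeSets {A ι : Type*} [Ring A] [Algebra ℂ A] (φ : A →ₗ[ℂ] ℂ) (s : ι → Set A) : Prop :=
  FreeSubalgebras φ fun i => Algebra.adjoin ℂ (s i)

/-- A semicircular element: self-adjoint, its odd moments vanish, and its moment of order `2n` is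
the `n`-th Catalan number. -/
structure IsSemicircular {A : Type*} [CStarAlgebra A] (φ : A →ₗ[ℂ] ℂ) (a : A) : Prop where
  selfAdjoint : IsSelfAdjoint a
  odd_moment : ∀ n : ℕ, φ (a ^ (2 * n + 1)) = 0
  even_moment : ∀ n : ℕ, φ (a ^ (2 * n)) = (catalan n : ℂ)

/-- A circular element: `(a + √-1 b) / √2` with `a`, `b` free semicircular elements. -/
def IsCircular {A : Type*} [CStarAlgebra A] (φ : A →ₗ[ℂ] ℂ) (c : A) : Prop :=
  ∃ a b : A, IsSemicircular φ a ∧ IsSemicircular φ b ∧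
    FreeSets φ (![{a}, {b}] : Fin 2 → Set A) ∧
    c = (((Real.sqrt 2)⁻¹ : ℝ) : ℂ) • (a + Complex.I • b)

/-- `(A, φ)` is a C⋆-probability space and `c` is a family of circular elements in it such that
the sets `{c i, (c i)⋆}` are free. -/
structure IsFreeCircularFamily {A ι : Type*} [CStarAlgebra A] (φ : A →ₗ[ℂ] ℂ) (c : ι → A) :
    Prop where
  state : IsState φ
  circular : ∀ i, IsCircular φ (c i)
  free : FreeSets φ fun i => ({c i, star (c i)} : Set A)

end RandomConvolution

end

open RandomConvolution

open RandomConvolution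
open scoped BigOperators

/-! The mixed ⋆-moments are compared word by word. Each matrix is `|G|^{-1/2}` times a Gaussian
combination of translations, so Wick's formula turns a normalized moment into a sum over pairings of
letters `c i` with letters `(c i)⋆`. A pairing contributes the probability that a group word is
trivial, where the two letters of a pair carry `g` and `g⁻¹` and the `g` are independent and uniform
(`meanTrace_word`).

If the pairing is noncrossing, the group word cancels freely and the probability is `1`. If two
pairs cross, the word has the form `h⁻¹ p a⁻¹ u h v a q`. For fixed `a`, the `h` that make it equal
to a given element are none or a coset of the centralizer of `p a⁻¹ u`, and `p a⁻¹ u` is uniform, so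
the probability is at most that of two uniform elements commuting (`expect_crossing_le`). That
number is the quotient of the number of conjugacy classes by `|G|`. It is at most `|Ĝ| / |G| = ∫ n⁻²
dμ̃`, which tends to `0` because `n ↦ n⁻²` extends continuously by `0` at `∞` (`tendsto_commRatio`).

Pairings are enumerated by reading the word while keeping a list of open letters, most recent first:
a letter stays open or closes an open letter of opposite type. Noncrossing means that only the head
is ever closed (`abs_letterExpect_pairingSum_sub_le`).

On the limit side, freeness determines the joint distribution (`distribution_eq_of_free`), so one
model suffices: circular operators on the full Fock space, which provide the existence as well.
There creation opens a letter and annihilation closes the head, so the vacuum moments are the same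
noncrossing counts (`vacuum_word`). -/

noncomputable section

/-! ### Sums over the choice of one entry of a list. -/

section Splits

variable {α M : Type*} [AddCommMonoid M]

/-- The sum of `f A t B` over all decompositions `S = A ++ t :: B`. -/
def splitSum : List α → (List α → α → List α → M) → M
  | [], _ => 0
  | s :: S, f => f [] s S + splitSum S fun A t B => f (s :: A) t B

theorem splitSum_congr (S : List α) (f g : List α → α → List α → M)
    (h : ∀ A t B, S = A ++ t :: B → f A t B = g A t B) : splitSum S f = splitSum S g := by
  induction S generalizing f g with
  | nil => rfl
  | cons s S ih =>
    simp only [splitSum]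
    rw [h [] s S rfl, ih _ (fun A t B => g (s :: A) t B)]
    intro A t B e
    exact h _ _ _ (by simp [e])

theorem splitSum_append (S T : List α) (f : List α → α → List α → M) :
    splitSum (S ++ T) f =
      splitSum S (fun A t B => f A t (B ++ T)) + splitSum T fun A t B => f (S ++ A) t B := by
  induction S generalizing f with
  | nil => simp [splitSum]
  | cons s S ih => simp [splitSum, ih, add_assoc]

theorem splitSum_map_hom {M' F : Type*} [AddCommMonoid M'] [FunLike F M M']
    [AddMonoidHomClass F M M'] (φ : F) (S : List α)
    (f : List α → α → List α → M) :
    φ (splitSum S f) = splitSum S fun A t B => φ (f A t B) := by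
  induction S generalizing f with
  | nil => simp [splitSum]
  | cons s S ih => simp [splitSum, ih, map_add]

theorem splitSum_add (S : List α) (f g : List α → α → List α → M) :
    splitSum S (fun A t B => f A t B + g A t B) = splitSum S f + splitSum S g := by
  induction S generalizing f g with
  | nil => simp [splitSum]
  | cons s S ih => simp only [splitSum, ih]; abel

theorem splitSum_finsetSum {J : Type*} (s : Finset J) (S : List α)
    (f : J → List α → α → List α → M) :
    ∑ j ∈ s, splitSum S (f j) = splitSum S fun A t B => ∑ j ∈ s, f j A t B := by
  induction S generalizing f with
  | nil => simp [splitSum]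
  | cons a S ih => simp only [splitSum, Finset.sum_add_distrib, ih]

theorem splitSum_expect {J : Type*} [Fintype J] (S : List α)
    (f : J → List α → α → List α → ℝ) :
    𝔼 j, splitSum S (f j) = splitSum S fun A t B => 𝔼 j, f j A t B := by
  induction S generalizing f with
  | nil => simp [splitSum]
  | cons a S ih => simp only [splitSum, Finset.expect_add_distrib, ih]

theorem abs_splitSum_le (S : List α) (f : List α → α → List α → ℝ) (c : ℝ)
    (h : ∀ A t B, S = A ++ t :: B → |f A t B| ≤ c) : |splitSum S f| ≤ S.length * c := by
  induction S generalizing f with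
  | nil => simp [splitSum]
  | cons s S ih =>
    simp only [splitSum, List.length_cons, Nat.cast_add, Nat.cast_one]
    have h1 := h [] s S rfl
    have h2 := ih (fun A t B => f (s :: A) t B) fun A t B e => h _ _ _ (by simp [e])
    calc _ ≤ _ := abs_add_le _ _
      _ ≤ c + S.length * c := add_le_add h1 h2
      _ = _ := by ring

end Splits

section Letters

variable {ι G : Type*} [Group G]

/-- The group element that a letter contributes: `g` for `c i` and `g⁻¹` for `(c i)⋆`. -/
def letterVal : ι ⊕ ι → G → G
  | .inl _, g => g
  | .inr _, g => g⁻¹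

@[simp] theorem letterVal_swap (x : ι ⊕ ι) (g : G) :
    letterVal x.swap g = (letterVal x g)⁻¹ := by cases x <;> simp [letterVal]

theorem letterVal_bijective (x : ι ⊕ ι) : Function.Bijective (letterVal (G := G) x) := by
  cases x
  · exact Function.bijective_id
  · exact inv_involutive.bijective

end Letters

/-! ### Pairings of a word, and the smallness of the crossing ones. -/

section Pairings

variable {ι G : Type*} [DecidableEq ι] [Group G] [Fintype G] [DecidableEq G]

/-- The probability that two independent uniform elements of `G` commute. -/
def commRatio (G : Type*) [Group G] [Fintype G] [DecidableEq G] : ℝ :=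
  𝔼 p : G × G, if p.1 * p.2 = p.2 * p.1 then 1 else 0

/-- The sum over all pairings of the letters of the word `w` among each other and with the open
letters `S` of the probability that the resulting group word, multiplied by `V`, is trivial. -/
def pairingSum : List (ι ⊕ ι) → List ((ι ⊕ ι) × G) → G → ℝ
  | [], S, V => if S = [] ∧ V = 1 then 1 else 0
  | x :: w, S, V =>
      (𝔼 g : G, pairingSum w ((x, g) :: S) (letterVal x g * V)) +
        splitSum S fun A t B =>
          if t.1 = x.swap then pairingSum w (A ++ B) (letterVal x t.2 * V) else 0

/-- The number of noncrossing pairings of the letters of `w` and the open letters `T`. -/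
def noncrossingSum : List (ι ⊕ ι) → List (ι ⊕ ι) → ℝ
  | [], T => if T = [] then 1 else 0
  | x :: w, [] => noncrossingSum w [x]
  | x :: w, y :: T =>
      noncrossingSum w (x :: y :: T) + if y = x.swap then noncrossingSum w T else 0

/-- A bound for the number of pairings of a word of length `k` and of `r` open letters. -/
def pairingBound : ℕ → ℕ → ℝ
  | 0, _ => 1
  | k + 1, r => pairingBound k (r + 1) + r * pairingBound k (r - 1)

theorem pairingBound_nonneg (k r : ℕ) : 0 ≤ pairingBound k r := by
  induction k generalizing r with
  | zero => simp [pairingBound]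
  | succ k ih =>
    simp only [pairingBound]
    exact add_nonneg (ih _) (mul_nonneg (Nat.cast_nonneg _) (ih _))

theorem commRatio_nonneg : 0 ≤ commRatio G :=
  Finset.expect_nonneg fun p _ => by split_ifs <;> norm_num

theorem abs_expect_le_of_abs_le {J : Type*} [Fintype J] [Nonempty J] {f : J → ℝ} {c : ℝ}
    (h : ∀ j, |f j| ≤ c) : |𝔼 j, f j| ≤ c := by
  refine abs_le.2 ⟨?_, ?_⟩
  · calc -c = 𝔼 _j : J, -c := (Fintype.expect_const _).symm
      _ ≤ _ := Finset.expect_le_expect fun j _ => (abs_le.1 (h j)).1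
  · calc _ ≤ 𝔼 _j : J, c := Finset.expect_le_expect fun j _ => (abs_le.1 (h j)).2
      _ = c := Fintype.expect_const _

theorem expect_prod {J K : Type*} [Fintype J] [Fintype K] (f : J × K → ℝ) :
    𝔼 p, f p = 𝔼 j, 𝔼 k, f (j, k) := by
  rw [← Finset.univ_product_univ, Finset.expect_product]

/-- Once a crossing has occurred, the contribution of all further pairings is small. -/
theorem abs_expect_pairingSum_le {J : Type*} [Fintype J] {δ : ℝ} (hδ : 0 ≤ δ)
    (w : List (ι ⊕ ι)) (S : List ((ι ⊕ ι) × G)) (V : J → G)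
    (hV : ∀ z, (𝔼 j, if V j = z then (1 : ℝ) else 0) ≤ δ) :
    |𝔼 j, pairingSum w S (V j)| ≤ pairingBound w.length S.length * δ := by
  induction w generalizing S V with
  | nil =>
    simp only [pairingSum, pairingBound, List.length_nil, one_mul]
    by_cases hS : S = []
    · simp only [hS, true_and]
      rw [abs_of_nonneg (Finset.expect_nonneg fun j _ => by split_ifs <;> norm_num)]
      exact hV 1
    · simpa [hS] using hδ
  | cons x w ih =>
    -- The bound on all point masses is invariant under left translation, which is all that later
    -- letters do to `V`.
    have hV' : ∀ c z, (𝔼 j, if c * V j = z then (1 : ℝ) else 0) ≤ δ := by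
      intro c z
      simpa [← eq_inv_mul_iff_mul_eq] using hV (c⁻¹ * z)
    simp only [pairingSum, Finset.expect_add_distrib, List.length_cons, pairingBound, add_mul]
    refine (abs_add_le _ _).trans (add_le_add ?_ ?_)
    · rw [Finset.expect_comm]
      exact abs_expect_le_of_abs_le fun g => ih _ _ (hV' _)
    · rw [splitSum_expect, mul_assoc]
      refine abs_splitSum_le _ _ _ fun A t B e => ?_
      by_cases ht : t.1 = x.swap
      · simp only [ht, if_true]
        have := ih (A ++ B) _ (hV' (letterVal x t.2))
        have hl : (A ++ B).length = S.length - 1 := by simp [e]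
        rwa [hl] at this
      · simp only [ht, if_false, Finset.expect_const_zero, abs_zero]
        exact mul_nonneg (pairingBound_nonneg _ _) hδ

/-- The solutions, if any, form a coset of the centralizer of `c`: right multiplication by the
inverse of one solution carries them into it. -/
theorem card_conj_eq_le_card_commute (c d : G) :
    (Finset.univ.filter fun h : G => h⁻¹ * c * h = d).card ≤
      (Finset.univ.filter fun h : G => h * c = c * h).card := by
  rcases (Finset.univ.filter fun h : G => h⁻¹ * c * h = d).eq_empty_or_nonempty with h0 | ⟨h₀, h0⟩
  · simp [h0]
  · simp only [Finset.mem_filter, Finset.mem_univ, true_and] at h0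
    refine Finset.card_le_card_of_injOn (fun h => h * h₀⁻¹) ?_ (by intro a _ b _ h; simpa using h)
    intro h hh
    simp only [Finset.coe_filter, Finset.mem_univ, true_and, Set.mem_ofPred_eq] at hh ⊢
    have e : c * h = h * d := by rw [← hh]; group
    have e' : c = h₀ * d * h₀⁻¹ := by rw [← h0]; group
    calc h * h₀⁻¹ * c = h * d * h₀⁻¹ := by rw [e']; group
      _ = c * (h * h₀⁻¹) := by rw [← e]; group

/-- A crossing pair of letters makes a group word at most as likely to be equal to a given element
as two group elements are to commute. -/
theorem expect_crossing_le (p u v q z : G) :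
    (𝔼 k : G × G, if k.1⁻¹ * p * k.2⁻¹ * u * k.1 * v * k.2 * q = z then (1 : ℝ) else 0)
      ≤ commRatio G := by
  -- With `a` fixed, the equation says that `h` conjugates `p * a⁻¹ * u` to a given element.
  have key : ∀ a : G,
      (𝔼 h : G, if h⁻¹ * p * a⁻¹ * u * h * v * a * q = z then (1 : ℝ) else 0) ≤
        𝔼 h : G, if h * (p * a⁻¹ * u) = (p * a⁻¹ * u) * h then (1 : ℝ) else 0 := by
    intro a
    have := card_conj_eq_le_card_commute (p * a⁻¹ * u) (z * q⁻¹ * a⁻¹ * v⁻¹)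
    simp only [Fintype.expect_eq_sum_div_card, Finset.sum_boole]
    have e : (Finset.univ.filter fun h : G => h⁻¹ * p * a⁻¹ * u * h * v * a * q = z) =
        Finset.univ.filter fun h : G => h⁻¹ * (p * a⁻¹ * u) * h = z * q⁻¹ * a⁻¹ * v⁻¹ := by
      refine Finset.filter_congr fun h _ => ?_
      constructor
      · rintro rfl; group
      · intro e
        calc _ = (h⁻¹ * (p * a⁻¹ * u) * h) * v * a * q := by group
          _ = z := by rw [e]; group
    rw [e]
    exact div_le_div_of_nonneg_right (Nat.cast_le.2 this) (Nat.cast_nonneg _)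
  rw [(expect_prod _).trans (Finset.expect_comm _ _ _), commRatio,
    (expect_prod _).trans (Finset.expect_comm _ _ _)]
  refine (Finset.expect_le_expect fun a _ => key a).trans_eq ?_
  -- As `a` is uniform, so is `p * a⁻¹ * u`.
  refine Fintype.expect_bijective (fun a : G => p * a⁻¹ * u) ?_ _ _ fun a => rfl
  exact ((Group.mulRight_bijective u).comp (Group.mulLeft_bijective p)).comp
    inv_involutive.bijective

/-- The contribution of the pairings in which the open letter `y` is crossed. -/
theorem abs_expect_pairingSum_crossed_le (w : List (ι ⊕ ι)) (y : ι ⊕ ι)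
    (S T : List ((ι ⊕ ι) × G)) (p u v q : G) :
    |𝔼 k : G × G, pairingSum w (S ++ (y, k.1) :: T)
        (p * k.2⁻¹ * u * letterVal y k.1 * v * k.2 * q)| ≤
      pairingBound w.length (S.length + T.length + 1) * commRatio G := by
  induction w generalizing S T p with
  -- The letter `y` is still open when the word ends, so the sum is `0`.
  | nil => simpa [pairingSum, pairingBound] using commRatio_nonneg
  | cons x w ih =>
    have hK := mul_nonneg (pairingBound_nonneg w.length (S.length + T.length))
      (commRatio_nonneg (G := G))
    simp only [pairingSum, Finset.expect_add_distrib, List.length_cons, pairingBound, add_mul,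
      splitSum_append, splitSum, splitSum_expect]
    refine (abs_add_le _ _).trans (add_le_add ?_ ?_)
    · rw [Finset.expect_comm]
      refine abs_expect_le_of_abs_le fun g => ?_
      have := ih ((x, g) :: S) T (letterVal x g * p)
      simp only [List.length_cons, add_right_comm _ 1 T.length, mul_assoc, List.cons_append] at this ⊢
      exact this
    -- The three cases are that `x` closes a letter of `S` (`h1`), a letter of `T` (`h3`) or `y`
    -- itself (`h2`). In the first two `y` stays open and the value of `x` is absorbed into `p`.
    · have h1 : |splitSum S fun A t B => 𝔼 k : G × G,
          (if t.1 = x.swap then pairingSum w (A ++ (B ++ (y, k.1) :: T)) (letterVal x t.2 *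
            (p * k.2⁻¹ * u * letterVal y k.1 * v * k.2 * q)) else 0)| ≤
          S.length * (pairingBound w.length (S.length + T.length) * commRatio G) := by
        refine abs_splitSum_le _ _ _ fun A t B e => ?_
        by_cases ht : t.1 = x.swap
        · simp only [ht, if_true]
          have := ih (A ++ B) T (letterVal x t.2 * p)
          have hl : (A ++ B).length + T.length + 1 = S.length + T.length := by simp [e]; ring
          rw [hl] at this
          simpa only [mul_assoc, List.append_assoc] using this
        · simpa [ht] using hK
      have h3 : |splitSum T fun A t B => 𝔼 k : G × G,
          (if t.1 = x.swap then pairingSum w ((S ++ (y, k.1) :: A) ++ B) (letterVal x t.2 *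
            (p * k.2⁻¹ * u * letterVal y k.1 * v * k.2 * q)) else 0)| ≤
          T.length * (pairingBound w.length (S.length + T.length) * commRatio G) := by
        refine abs_splitSum_le _ _ _ fun A t B e => ?_
        by_cases ht : t.1 = x.swap
        · simp only [ht, if_true]
          have := ih S (A ++ B) (letterVal x t.2 * p)
          have hl : S.length + (A ++ B).length + 1 = S.length + T.length := by simp [e]; ring
          rw [hl] at this
          simpa only [mul_assoc, List.append_assoc, List.cons_append] using this
        · simpa [ht] using hK
      -- Closing `y` makes the two pairs interleave as `k.1⁻¹ … k.2⁻¹ … k.1 … k.2`, up to replacing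
      -- `k.1` by `letterVal x.swap k.1`. Every value of the product now has probability at most
      -- `commRatio G`, whatever the remaining letters do.
      have h2 : |𝔼 k : G × G,
          (if y = x.swap then pairingSum w (S ++ T) (letterVal x k.1 *
            (p * k.2⁻¹ * u * letterVal y k.1 * v * k.2 * q)) else 0)| ≤
          pairingBound w.length (S.length + T.length) * commRatio G := by
        by_cases hy : y = x.swap
        · simp only [hy, if_true]
          have := abs_expect_pairingSum_le (commRatio_nonneg (G := G)) w (S ++ T)
            (fun k : G × G => letterVal x k.1 *
              (p * k.2⁻¹ * u * (letterVal x.swap k.1) * v * k.2 * q)) ?_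
          · simpa only [List.length_append] using this
          · intro z
            refine (le_of_eq ?_).trans (expect_crossing_le p u v q z)
            refine Fintype.expect_bijective
              (fun k : G × G => (letterVal x.swap k.1, k.2)) ?_ _ _ fun k => ?_
            · exact (letterVal_bijective _).prodMap Function.bijective_id
            · simp [mul_assoc]
        · simpa [hy] using hK
      simp only [List.append_nil, Nat.cast_add, Nat.cast_one, Nat.add_sub_cancel,
        List.append_assoc, List.cons_append] at h1 h2 h3 ⊢
      refine (abs_add_le _ _).trans ((add_le_add h1 ((abs_add_le _ _).trans
        (add_le_add h2 h3))).trans_eq ?_)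
      ring

/-- The average over independent uniform group elements attached to the letters of `L`. -/
def letterExpect : List (ι ⊕ ι) → (List ((ι ⊕ ι) × G) → ℝ) → ℝ
  | [], F => F []
  | x :: L, F => letterExpect L fun S => 𝔼 g : G, F ((x, g) :: S)

omit [DecidableEq ι] [Group G] [DecidableEq G] in
theorem letterExpect_add (L : List (ι ⊕ ι)) (F F' : List ((ι ⊕ ι) × G) → ℝ) :
    letterExpect L (fun S => F S + F' S) = letterExpect L F + letterExpect L F' := by
  induction L generalizing F F' with
  | nil => rfl
  | cons x L ih => simp only [letterExpect, Finset.expect_add_distrib, ih]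

omit [DecidableEq ι] [Group G] [DecidableEq G] in
theorem abs_letterExpect_le [Nonempty G] (L : List (ι ⊕ ι)) (F : List ((ι ⊕ ι) × G) → ℝ) (c : ℝ)
    (h : ∀ S, S.length = L.length → |F S| ≤ c) : |letterExpect L F| ≤ c := by
  induction L generalizing F with
  | nil => exact h [] rfl
  | cons x L ih =>
    exact ih _ fun S hS => abs_expect_le_of_abs_le fun g => h _ (by simp [hS])

/-- The product of the group elements attached to a list of letters. -/
def letterProd (S : List ((ι ⊕ ι) × G)) : G := (S.map fun s => letterVal s.1 s.2).prod

omit [DecidableEq ι] [Group G] [DecidableEq G] in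
theorem letterExpect_splitSum (L : List (ι ⊕ ι))
    (f : List ((ι ⊕ ι) × G) → (ι ⊕ ι) × G → List ((ι ⊕ ι) × G) → ℝ) :
    letterExpect L (fun S => splitSum S f) =
      splitSum L fun A y B => letterExpect B fun SB =>
        letterExpect A fun SA => 𝔼 g : G, f SA (y, g) SB := by
  induction L generalizing f with
  | nil => rfl
  | cons y L ih =>
    simp only [letterExpect, splitSum, Finset.expect_add_distrib, letterExpect_add, splitSum_expect,
      ih]
    congr 2
    ext A y' B
    congr 2
    ext SB
    congr 1
    ext SA
    exact Finset.expect_comm _ _ _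

/-- Up to the contribution of the crossing pairings, the sum over all pairings is the number of
noncrossing pairings. -/
theorem abs_letterExpect_pairingSum_sub_le (w L : List (ι ⊕ ι)) :
    |letterExpect L (fun S => pairingSum w S (letterProd (G := G) S)) - noncrossingSum w L| ≤
      pairingBound w.length L.length * commRatio G := by
  induction w generalizing L with
  | nil =>
    have h0 := commRatio_nonneg (G := G)
    cases L with
    | nil => simpa [letterExpect, pairingSum, letterProd, noncrossingSum, pairingBound] using h0
    | cons x L =>
      simp only [pairingSum, noncrossingSum, pairingBound, letterExpect, List.length_nil]
      simp only [reduceCtorEq, false_and, if_false, Finset.expect_const_zero, sub_zero, one_mul]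
      exact abs_letterExpect_le _ _ _ fun _ _ => by simpa using h0
  | cons x w ih =>
    have hK := mul_nonneg (pairingBound_nonneg w.length (L.length - 1))
      (commRatio_nonneg (G := G))
    have hpush := ih (x :: L)
    simp only [pairingSum, letterExpect_add, List.length_cons, pairingBound]
    have e1 : letterExpect L (fun S : List ((ι ⊕ ι) × G) => 𝔼 g : G,
        pairingSum w ((x, g) :: S) (letterVal x g * letterProd S)) =
        letterExpect (x :: L) fun S : List ((ι ⊕ ι) × G) => pairingSum w S (letterProd S) := by
      simp [letterExpect, letterProd]
    have e2 : letterExpect L (fun S : List ((ι ⊕ ι) × G) => splitSum S fun A t B =>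
        if t.1 = x.swap then pairingSum w (A ++ B) (letterVal x t.2 * letterProd S) else 0) =
        letterExpect L (fun S : List ((ι ⊕ ι) × G) => splitSum S fun A t B =>
        if t.1 = x.swap then pairingSum w (A ++ B)
          (letterVal x t.2 * letterProd A * letterVal t.1 t.2 * letterProd B) else 0) := by
      congr 1
      ext S
      refine splitSum_congr _ _ _ fun A t B e => ?_
      simp [e, letterProd, mul_assoc]
    -- If the closed letter `y` is not the head, the more recent head `a` is enclosed by the new
    -- pair and can only be closed outside it, so a crossing is inevitable.
    have hcross : ∀ (a : ι ⊕ ι) (A : List (ι ⊕ ι)) (y : ι ⊕ ι) (B : List (ι ⊕ ι)),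
        |letterExpect B fun SB : List ((ι ⊕ ι) × G) =>
          letterExpect (a :: A) fun SA : List ((ι ⊕ ι) × G) => 𝔼 g : G,
          if y = x.swap then pairingSum w (SA ++ SB)
            (letterVal x g * letterProd SA * letterVal y g * letterProd SB) else 0| ≤
          pairingBound w.length (A.length + B.length + 1) * commRatio G := by
      intro a A y B
      have hK' := mul_nonneg (pairingBound_nonneg w.length (A.length + B.length + 1))
        (commRatio_nonneg (G := G))
      simp only [letterExpect]
      refine abs_letterExpect_le _ _ _ fun SB hB => abs_letterExpect_le _ _ _ fun SA hA => ?_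
      by_cases hy : y = x.swap
      · simp only [hy, if_true]
        -- Here `k.1` is the value at `a`, and `k.2` is the value contributed by the closed letter
        -- `y`, so that `x` contributes `k.2⁻¹`.
        have := abs_expect_pairingSum_crossed_le w a ([] : List ((ι ⊕ ι) × G)) (SA ++ SB) 1 1
          (letterProd SA)
          (letterProd SB)
        rw [← expect_prod fun k : G × G => pairingSum w ((a, k.1) :: SA ++ SB)
          (letterVal x k.2 * letterProd ((a, k.1) :: SA) * letterVal x.swap k.2 * letterProd SB)]
        have hl : ([] : List ((ι ⊕ ι) × G)).length + (SA ++ SB).length + 1 =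
          A.length + B.length + 1 := by simp [hA, hB]
        rw [hl] at this
        refine le_of_eq_of_le (congrArg abs ?_) this
        refine Fintype.expect_bijective
          (fun k : G × G => (k.1, letterVal x.swap k.2)) ?_ _ _ fun k => ?_
        · exact Function.bijective_id.prodMap (letterVal_bijective _)
        · simp [mul_assoc, letterProd]
      · simpa [hy] using hK'
    rw [e1, e2, letterExpect_splitSum]
    cases L with
    | nil => simpa [splitSum, noncrossingSum] using hpush
    | cons y T =>
      have hpop := ih T
      simp only [splitSum, noncrossingSum]
      -- Closing the head cancels two adjacent inverse group elements and leaves the statement for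
      -- `T`.
      have h1 : |(letterExpect T fun SB : List ((ι ⊕ ι) × G) =>
          letterExpect [] fun SA : List ((ι ⊕ ι) × G) => 𝔼 g : G,
          if y = x.swap then pairingSum w (SA ++ SB)
            (letterVal x g * letterProd SA * letterVal y g * letterProd SB) else 0) -
          if y = x.swap then noncrossingSum w T else 0| ≤
          pairingBound w.length T.length * commRatio G := by
        by_cases hy : y = x.swap
        · simpa [hy, letterExpect, letterProd] using hpop
        · simpa [hy, letterExpect] using (abs_letterExpect_le T
            (fun _ : List ((ι ⊕ ι) × G) => (0 : ℝ)) _ fun _ _ => by simpa using hK)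
      have h2 := abs_splitSum_le T (fun A t B => letterExpect B fun SB : List ((ι ⊕ ι) × G) =>
        letterExpect (y :: A) fun SA : List ((ι ⊕ ι) × G) => 𝔼 g : G, if t = x.swap then pairingSum w (SA ++ SB)
            (letterVal x g * letterProd SA * letterVal t g * letterProd SB) else 0)
          (pairingBound w.length T.length * commRatio G) (fun A t B e => by
            have := hcross y A t B
            have hl : A.length + B.length + 1 = T.length := by simp [e]; ring
            rwa [hl] at this)
      simp only [List.length_cons, Nat.cast_add, Nat.cast_one, Nat.add_sub_cancel] at hpush ⊢
      rw [abs_le] at hpush h1 h2 ⊢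
      constructor <;> linarith [hpush.1, hpush.2, h1.1, h1.2, h2.1, h2.2]

end Pairings

/-! ### Random variables with finite moments, and expectation as a functional on polynomials. -/

section Moments

variable {Ω : Type*} [MeasurableSpace Ω]

/-- The algebra of the complex random variables all of whose moments are finite. -/
def finiteMoments (P : Measure Ω) [IsFiniteMeasure P] : Subalgebra ℂ (Ω → ℂ) where
  carrier := {f | ∀ p : NNReal, MemLp f p P}
  mul_mem' := by
    intro f g hf hg p
    have h2 : ENNReal.HolderTriple ((2 * p : NNReal) : ENNReal) ((2 * p : NNReal) : ENNReal) p := by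
      rw [ENNReal.holderTriple_iff, ← two_mul]
      rcases eq_or_ne p 0 with rfl | hp
      · simp
      · rw [ENNReal.coe_mul, ENNReal.mul_inv (by simp) (by simp), ← mul_assoc]
        simp [ENNReal.mul_inv_cancel]
    exact (hg _).mul (hf _) (hpqr := h2)
  add_mem' := fun hf hg p => (hf p).add (hg p)
  algebraMap_mem' := fun c p => memLp_const c

theorem integrable_of_mem_finiteMoments {P : Measure Ω} [IsFiniteMeasure P] {f : Ω → ℂ}
    (hf : f ∈ finiteMoments P) : Integrable f P := memLp_one_iff_integrable.1 (by simpa using hf 1)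

theorem sum_mem_finiteMoments {P : Measure Ω} [IsFiniteMeasure P] {J : Type*} (s : Finset J)
    {f : J → Ω → ℂ} (hf : ∀ j ∈ s, f j ∈ finiteMoments P) :
    (fun ω => ∑ j ∈ s, f j ω) ∈ finiteMoments P := by
  simpa [Finset.sum_fn] using sum_mem hf

theorem eval_mem_finiteMoments {P : Measure Ω} [IsFiniteMeasure P] {σ : Type*}
    {z : Ω → σ → ℂ} (hz : ∀ s, (fun ω => z ω s) ∈ finiteMoments P) (p : MvPolynomial σ ℂ) :
    (fun ω => MvPolynomial.eval (z ω) p) ∈ finiteMoments P := by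
  induction p using MvPolynomial.induction_on with
  | C a => simp only [MvPolynomial.eval_C]; exact (finiteMoments P).algebraMap_mem a
  | add p q hp hq => simp only [map_add]; exact add_mem hp hq
  | mul_X p s hp => simp only [map_mul, MvPolynomial.eval_X]; exact mul_mem hp (hz s)

/-- The expectation of polynomials in random variables with finite moments. -/
def expectEval (P : Measure Ω) [IsFiniteMeasure P] {σ : Type*}
    (z : Ω → σ → ℂ) (hz : ∀ s, (fun ω => z ω s) ∈ finiteMoments P) :
    MvPolynomial σ ℂ →ₗ[ℂ] ℂ where
  toFun p := ∫ ω, MvPolynomial.eval (z ω) p ∂P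
  map_add' p q := by
    simp only [map_add]
    exact integral_add (integrable_of_mem_finiteMoments (eval_mem_finiteMoments hz p))
      (integrable_of_mem_finiteMoments (eval_mem_finiteMoments hz q))
  map_smul' c p := by simp [integral_const_mul]

/-- Both sides are linear in `p`, so integration by parts needs checking only on monomials, where
independence factors the expectation. -/
theorem linearMap_X_mul_eq_of_monomial {σ : Type*} (E : MvPolynomial σ ℂ →ₗ[ℂ] ℂ)
    (i j : σ) (c : ℂ)
    (h : ∀ s : σ →₀ ℕ, E (.X i * MvPolynomial.monomial s 1) =
        c * E (MvPolynomial.pderiv j (MvPolynomial.monomial s 1)))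
    (p : MvPolynomial σ ℂ) : E (.X i * p) = c * E (MvPolynomial.pderiv j p) := by
  have : E ∘ₗ LinearMap.mulLeft ℂ (MvPolynomial.X i) =
      c • E ∘ₗ (MvPolynomial.pderiv j).toLinearMap := by
    refine (MvPolynomial.basisMonomials σ ℂ).ext fun s => ?_
    simpa using h s
  exact LinearMap.congr_fun this p

end Moments

/-! ### Gaussian integration by parts in one real and one complex variable. -/

section Gaussian

theorem integrable_pow_gaussianReal (v : NNReal) (k : ℕ) :
    Integrable (fun x => x ^ k) (gaussianReal 0 v) := by
  have h := memLp_id_gaussianReal (μ := 0) (v := v) k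
  rcases Nat.eq_zero_or_pos k with rfl | hk
  · simp
  have := h.integrable_norm_pow hk.ne'
  refine (integrable_norm_iff (by fun_prop)).1 ?_
  simpa using this

/-- The derivative of the density times `x ^ k` integrates to `0`. For `k = 0` the truncated
exponent `k - 1` is harmless, since its coefficient vanishes. -/
theorem integral_pow_succ_gaussianReal {v : NNReal} (hv : v ≠ 0) (k : ℕ) :
    ∫ x, x ^ (k + 1) ∂(gaussianReal 0 v) = v * (k * ∫ x, x ^ (k - 1) ∂(gaussianReal 0 v)) := by
  have hv' : (v : ℝ) ≠ 0 := by exact_mod_cast hv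
  have hint : ∀ k : ℕ, Integrable (fun x => gaussianPDFReal 0 v x * x ^ k) := by
    intro k
    have := integrable_pow_gaussianReal v k
    rw [gaussianReal_of_var_ne_zero _ hv, integrable_withDensity_iff_integrable_smul'
      (measurable_gaussianPDF _ _) (ae_of_all _ fun _ => gaussianPDF_lt_top)] at this
    simpa [toReal_gaussianPDF] using this
  have hd : ∀ x, HasDerivAt (fun x => gaussianPDFReal 0 v x * x ^ k)
      (k * (gaussianPDFReal 0 v x * x ^ (k - 1)) -
        (v : ℝ)⁻¹ * (gaussianPDFReal 0 v x * x ^ (k + 1))) x := by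
    intro x
    have h1 : HasDerivAt (gaussianPDFReal 0 v) (-(v : ℝ)⁻¹ * x * gaussianPDFReal 0 v x) x := by
      have : HasDerivAt (fun x : ℝ => -(x - 0) ^ 2 / (2 * v)) (-(v : ℝ)⁻¹ * x) x := by
        refine HasDerivAt.congr_deriv
          (((((hasDerivAt_id x).sub_const 0).pow 2).neg).div_const (2 * (v : ℝ))) ?_
        simp only [id, sub_zero]
        field_simp
        norm_num
      refine HasDerivAt.congr_deriv ((this.exp).const_mul (√(2 * Real.pi * v))⁻¹) ?_
      simp only [gaussianPDFReal]
      ring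
    refine HasDerivAt.congr_deriv (h1.mul (hasDerivAt_pow k x)) ?_
    ring
  have h0 := integral_eq_zero_of_hasDerivAt_of_integrable hd
    (((hint (k - 1)).const_mul _).sub ((hint (k + 1)).const_mul _)) (hint k)
  rw [integral_sub ((hint (k - 1)).const_mul _) ((hint (k + 1)).const_mul _),
    integral_const_mul, integral_const_mul, sub_eq_zero] at h0
  simp only [integral_gaussianReal_eq_integral_smul hv, smul_eq_mul]
  rw [h0]
  field_simp

theorem ofReal_mem_finiteMoments {Ω : Type*} [MeasurableSpace Ω] {P : Measure Ω}
    [IsProbabilityMeasure P] {U : Ω → ℝ} {v : NNReal} (hU : HasLaw U (gaussianReal 0 v) P) :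
    (fun ω => (U ω : ℂ)) ∈ finiteMoments P := by
  intro p
  have h1 : MemLp id p (P.map U) := by rw [hU.map_eq]; exact memLp_id_gaussianReal p
  have h2 := h1.comp_of_map hU.aemeasurable
  exact h2.ofReal

theorem integral_pow_succ_of_hasLaw {Ω : Type*} [MeasurableSpace Ω] {P : Measure Ω}
    {U : Ω → ℝ} {v : NNReal} (hv : v ≠ 0) (hU : HasLaw U (gaussianReal 0 v) P)
    (k : ℕ) : ∫ ω, (U ω : ℂ) ^ (k + 1) ∂P = v * (k * ∫ ω, (U ω : ℂ) ^ (k - 1) ∂P) := by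
  have h (n : ℕ) : ∫ ω, (U ω : ℂ) ^ n ∂P = ((∫ x, x ^ n ∂(gaussianReal 0 v) : ℝ) : ℂ) := by
    rw [← hU.map_eq, integral_map hU.aemeasurable (by fun_prop), ← integral_complex_ofReal]
    simp
  rw [h, h, integral_pow_succ_gaussianReal hv]
  push_cast
  rfl

variable {Ω : Type*} [MeasurableSpace Ω] {P : Measure Ω} [IsProbabilityMeasure P]

theorem RandomConvolution.IsStdComplexGaussian.mem_finiteMoments {Z : Ω → ℂ} (hZ : IsStdComplexGaussian Z P) :
    Z ∈ finiteMoments P := by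
  have : Z = (fun ω => ((Z ω).re : ℂ)) + Complex.I • fun ω => ((Z ω).im : ℂ) := by
    ext ω; simp [mul_comm Complex.I]
  rw [this]
  exact add_mem (ofReal_mem_finiteMoments hZ.re_law)
    (Subalgebra.smul_mem _ (ofReal_mem_finiteMoments hZ.im_law) _)

theorem RandomConvolution.IsStdComplexGaussian.star_mem_finiteMoments {Z : Ω → ℂ}
    (hZ : IsStdComplexGaussian Z P) : (fun ω => star (Z ω)) ∈ finiteMoments P := by
  have : (fun ω => star (Z ω)) =
      (fun ω => ((Z ω).re : ℂ)) + (-Complex.I) • fun ω => ((Z ω).im : ℂ) := by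
    ext ω; apply Complex.ext <;> simp
  rw [this]
  exact add_mem (ofReal_mem_finiteMoments hZ.re_law)
    (Subalgebra.smul_mem _ (ofReal_mem_finiteMoments hZ.im_law) _)

/-- Integration by parts in the real and imaginary parts, each of variance `1/2`, combines into
multiplication by `Z` acting as `∂/∂Z̄` under the expectation, and multiplication by `Z̄` as `∂/∂Z`.
-/
theorem RandomConvolution.IsStdComplexGaussian.integral_pow_mul_star_pow {Z : Ω → ℂ}
    (hZ : IsStdComplexGaussian Z P) (a b : ℕ) :
    ∫ ω, Z ω ^ (a + 1) * star (Z ω) ^ b ∂P = b * ∫ ω, Z ω ^ a * star (Z ω) ^ (b - 1) ∂P ∧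
    ∫ ω, Z ω ^ a * star (Z ω) ^ (b + 1) ∂P = a * ∫ ω, Z ω ^ (a - 1) * star (Z ω) ^ b ∂P := by
  open MvPolynomial in
  let z : Ω → Fin 2 → ℂ := fun ω => ![((Z ω).re : ℂ), ((Z ω).im : ℂ)]
  have hz : ∀ s, (fun ω => z ω s) ∈ finiteMoments P := by
    intro s
    fin_cases s
    · exact ofReal_mem_finiteMoments hZ.re_law
    · exact ofReal_mem_finiteMoments hZ.im_law
  have hv : (1 / 2 : NNReal) ≠ 0 := by norm_num
  have hmon : ∀ s : Fin 2 →₀ ℕ, expectEval P z hz (monomial s 1) =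
      (∫ ω, ((Z ω).re : ℂ) ^ s 0 ∂P) * ∫ ω, ((Z ω).im : ℂ) ^ s 1 ∂P := by
    intro s
    rw [← hZ.indep.integral_fun_comp_mul_comp (f := fun x : ℝ => (x : ℂ) ^ s 0)
      (g := fun x : ℝ => (x : ℂ) ^ s 1) hZ.re_law.aemeasurable hZ.im_law.aemeasurable
      (by fun_prop) (by fun_prop)]
    simp [expectEval, eval_monomial, Finsupp.prod_fintype, z]
  have hibp : ∀ (i : Fin 2) (p : MvPolynomial (Fin 2) ℂ), expectEval P z hz (X i * p) =
      (1 / 2) * expectEval P z hz (pderiv i p) := by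
    intro i
    refine linearMap_X_mul_eq_of_monomial _ i i _ fun s => ?_
    rw [X, monomial_mul, pderiv_monomial, one_mul,
      show monomial (s - Finsupp.single i 1) ((1 : ℂ) * s i) =
        (s i : ℂ) • monomial (s - Finsupp.single i 1) (1 : ℂ) by simp [smul_monomial], map_smul, hmon, hmon,
      add_comm]
    fin_cases i
    · simp [integral_pow_succ_of_hasLaw hv hZ.re_law]; ring
    · simp [integral_pow_succ_of_hasLaw hv hZ.im_law]; ring
  let ζ : MvPolynomial (Fin 2) ℂ := X 0 + C Complex.I * X 1
  let ζ' : MvPolynomial (Fin 2) ℂ := X 0 - C Complex.I * X 1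
  have hev : ∀ a b, ∫ ω, Z ω ^ a * star (Z ω) ^ b ∂P = expectEval P z hz (ζ ^ a * ζ' ^ b) := by
    intro a b
    refine integral_congr_ae (ae_of_all _ fun ω => ?_)
    have h1 : Z ω = (Z ω).re + Complex.I * (Z ω).im := by
      conv_lhs => rw [← Complex.re_add_im (Z ω)]
      ring
    have h2 : star (Z ω) = (Z ω).re - Complex.I * (Z ω).im := by
      apply Complex.ext <;> simp
    simp only [map_mul, map_pow, ζ, ζ', map_add, map_sub, eval_X, eval_C, z]
    rw [h2]
    nth_rw 1 [h1]
    simp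
  have hII : (C Complex.I * C Complex.I : MvPolynomial (Fin 2) ℂ) = -1 := by
    rw [← C_mul, Complex.I_mul_I]; simp
  -- `D` and `D'` are twice the Wirtinger derivatives in `ζ'` and `ζ`; the `2` cancels the variance
  -- `1/2`.
  let D : Derivation ℂ (MvPolynomial (Fin 2) ℂ) (MvPolynomial (Fin 2) ℂ) :=
    pderiv 0 + Complex.I • pderiv 1
  let D' : Derivation ℂ (MvPolynomial (Fin 2) ℂ) (MvPolynomial (Fin 2) ℂ) :=
    pderiv 0 - Complex.I • pderiv 1
  have hD : ∀ p, expectEval P z hz (ζ * p) = (1 / 2) * expectEval P z hz (D p) := by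
    intro p
    simp only [ζ, D, add_mul, ← smul_eq_C_mul, map_add, map_smul, hibp,
      Derivation.add_apply, Derivation.smul_apply, smul_eq_mul, mul_add, smul_mul_assoc]
    ring
  have hD' : ∀ p, expectEval P z hz (ζ' * p) = (1 / 2) * expectEval P z hz (D' p) := by
    intro p
    simp only [ζ', D', sub_mul, ← smul_eq_C_mul, map_sub, map_smul, hibp,
      Derivation.sub_apply, Derivation.smul_apply, smul_eq_mul, mul_sub, smul_mul_assoc]
    ring
  have h1 : D ζ = 0 := by
    simp [D, ζ, pderiv_X, smul_eq_C_mul, hII]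
  have h2 : D ζ' = 2 := by
    simp [D, ζ', pderiv_X, smul_eq_C_mul, hII]; norm_num
  have h3 : D' ζ = 2 := by
    simp [D', ζ, pderiv_X, smul_eq_C_mul, hII]; norm_num
  have h4 : D' ζ' = 0 := by
    simp [D', ζ', pderiv_X, smul_eq_C_mul, hII]
  have e1 : D (ζ ^ a * ζ' ^ b) = (2 * b : ℂ) • (ζ ^ a * ζ' ^ (b - 1)) := by
    simp only [Derivation.leibniz, Derivation.leibniz_pow, h1, h2, smul_eq_mul, smul_eq_C_mul]
    simp [show (C (2 : ℂ) : MvPolynomial (Fin 2) ℂ) = 2 from map_ofNat C 2]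
    ring
  have e2 : D' (ζ ^ a * ζ' ^ b) = (2 * a : ℂ) • (ζ ^ (a - 1) * ζ' ^ b) := by
    simp only [Derivation.leibniz, Derivation.leibniz_pow, h3, h4, smul_eq_mul, smul_eq_C_mul]
    simp [show (C (2 : ℂ) : MvPolynomial (Fin 2) ℂ) = 2 from map_ofNat C 2]
    ring
  constructor
  · rw [hev, hev, pow_succ', mul_assoc, hD, e1, map_smul, smul_eq_mul]
    ring
  · rw [hev, hev, pow_succ' ζ', mul_left_comm, hD', e2, map_smul, smul_eq_mul]
    ring

end Gaussian

/-! ### Wick products, and moments as sums over pairings. -/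

section Wick

open MvPolynomial

variable {Ω K : Type*} [MeasurableSpace Ω] {P : Measure Ω} [IsProbabilityMeasure P]

/-- The values of the variables `Z k` and of their complex conjugates. -/
def withConj (Z : K → Ω → ℂ) (ω : Ω) : K ⊕ K → ℂ :=
  Sum.elim (fun k => Z k ω) fun k => star (Z k ω)

theorem withConj_mem_finiteMoments {Z : K → Ω → ℂ} (hZ : ∀ k, IsStdComplexGaussian (Z k) P)
    (s : K ⊕ K) : (fun ω => withConj Z ω s) ∈ finiteMoments P := by
  cases s
  · exact (hZ _).mem_finiteMoments
  · exact (hZ _).star_mem_finiteMoments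

theorem pderiv_pderiv_comm {σ : Type*} (i j : σ) (p : MvPolynomial σ ℂ) :
    pderiv i (pderiv j p) = pderiv j (pderiv i p) := by
  classical
  induction p using MvPolynomial.induction_on with
  | C a => simp
  | add p q hp hq => simp [hp, hq]
  | mul_X p k hp =>
    have h : ∀ l m : σ, pderiv l (pderiv m (X k : MvPolynomial σ ℂ)) = 0 := fun l m => by
      rw [pderiv_X, Pi.single_apply]
      split_ifs <;> simp
    simp only [pderiv_mul, map_add, hp, h]
    ring

/-- On monomials the expectation factors over the independent variables, and only the factor of the
variable `j` changes. -/
theorem expectEval_X_mul [Fintype K] [DecidableEq K] {Z : K → Ω → ℂ}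
    (hZ : ∀ k, IsStdComplexGaussian (Z k) P) (hind : iIndepFun Z P) (j : K ⊕ K)
    (p : MvPolynomial (K ⊕ K) ℂ) :
    expectEval P (withConj Z) (withConj_mem_finiteMoments hZ) (X j * p) =
      expectEval P (withConj Z) (withConj_mem_finiteMoments hZ) (pderiv j.swap p) := by
  set E := expectEval P (withConj Z) (withConj_mem_finiteMoments hZ) with hE
  let μ : K → ℕ → ℕ → ℂ := fun k a b => ∫ ω, Z k ω ^ a * star (Z k ω) ^ b ∂P
  have hmon : ∀ s : K ⊕ K →₀ ℕ, E (monomial s 1) = ∏ k, μ k (s (.inl k)) (s (.inr k)) := by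
    intro s
    have hmeas : ∀ k, AEMeasurable (Z k) P := fun k =>
      ((hZ k).mem_finiteMoments 1).aestronglyMeasurable.aemeasurable
    rw [← hind.integral_fun_prod_comp (f := fun k (x : ℂ) =>
      x ^ s (.inl k) * star x ^ s (.inr k)) hmeas (fun k => by fun_prop)]
    simp [hE, expectEval, eval_monomial, Finsupp.prod_fintype, withConj, Finset.prod_mul_distrib]
  have hμ1 : ∀ k a b, μ k (a + 1) b = b * μ k a (b - 1) := fun k a b =>
    ((hZ k).integral_pow_mul_star_pow a b).1
  have hμ2 : ∀ k a b, μ k a (b + 1) = a * μ k (a - 1) b := fun k a b =>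
    ((hZ k).integral_pow_mul_star_pow a b).2
  rw [linearMap_X_mul_eq_of_monomial E j j.swap 1, one_mul]
  intro s
  rw [one_mul, X, monomial_mul, pderiv_monomial, one_mul, one_mul,
    show monomial (s - Finsupp.single j.swap 1) (s j.swap : ℂ) =
      (s j.swap : ℂ) • monomial (s - Finsupp.single j.swap 1) (1 : ℂ) by simp [smul_monomial],
    map_smul, hmon, hmon, add_comm, smul_eq_mul]
  rcases j with k | k
  · rw [← Finset.mul_prod_erase _ _ (Finset.mem_univ k),
      ← Finset.mul_prod_erase _ _ (Finset.mem_univ k), ← mul_assoc]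
    congr 1
    · simp [hμ1]
    · refine Finset.prod_congr rfl fun k' hk' => ?_
      have : k ≠ k' := (Finset.ne_of_mem_erase hk').symm
      simp [this]
  · rw [← Finset.mul_prod_erase _ _ (Finset.mem_univ k),
      ← Finset.mul_prod_erase _ _ (Finset.mem_univ k), ← mul_assoc]
    congr 1
    · simp [hμ2]
    · refine Finset.prod_congr rfl fun k' hk' => ?_
      have : k ≠ k' := (Finset.ne_of_mem_erase hk').symm
      simp [this]

/-- The Wick product of a list of variables. -/
def wickProduct : List (K ⊕ K) → MvPolynomial (K ⊕ K) ℂ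
  | [] => 1
  | j :: S => X j * wickProduct S - pderiv j.swap (wickProduct S)

/-- Differentiation acts on Wick products as on ordinary products, because it commutes with the
derivative in the correction term. -/
theorem pderiv_wickProduct [DecidableEq K] (k : K ⊕ K) (S : List (K ⊕ K)) :
    pderiv k (wickProduct S) =
      splitSum S fun A t B => if t = k then wickProduct (A ++ B) else 0 := by
  induction S generalizing k with
  | nil => simp [wickProduct, splitSum]
  | cons j S ih =>
    simp only [wickProduct, splitSum, List.nil_append, List.cons_append, map_sub]
    rw [pderiv_mul, pderiv_pderiv_comm, ih k, pderiv_X]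
    have h1 : X j * splitSum S (fun A t B => if t = k then wickProduct (A ++ B) else 0) =
        splitSum S (fun A t B => X j * if t = k then wickProduct (A ++ B) else 0) :=
      splitSum_map_hom (AddMonoidHom.mulLeft (X j)) S _
    rw [h1, splitSum_map_hom (pderiv j.swap), add_sub_assoc]
    congr 1
    · simp [Pi.single_apply]
    · rw [sub_eq_iff_eq_add, ← splitSum_add]
      refine splitSum_congr _ _ _ fun A t B _ => ?_
      split_ifs <;> simp

theorem splitSum_map {α β M : Type*} [AddCommMonoid M] (φ : α → β) (S : List α)
    (f : List β → β → List β → M) :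
    splitSum (S.map φ) f = splitSum S fun A t B => f (A.map φ) (φ t) (B.map φ) := by
  induction S generalizing f with
  | nil => rfl
  | cons s S ih => simp [splitSum, ih]

theorem expectEval_wickProduct [Fintype K] [DecidableEq K] {Z : K → Ω → ℂ}
    (hZ : ∀ k, IsStdComplexGaussian (Z k) P) (hind : iIndepFun Z P) (S : List (K ⊕ K)) :
    expectEval P (withConj Z) (withConj_mem_finiteMoments hZ) (wickProduct S) =
      if S = [] then 1 else 0 := by
  cases S with
  | nil => simp [wickProduct, expectEval]
  | cons j S => simp [wickProduct, expectEval_X_mul hZ hind]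

variable {ι G : Type*} [Group G]

/-- The random variable attached to a letter and a group element. -/
def gaussIndex (x : ι ⊕ ι) (g : G) : (ι × G) ⊕ (ι × G) := x.map (·, g) (·, g)

omit [Group G] in
theorem gaussIndex_eq_swap_iff (x y : ι ⊕ ι) (g h : G) :
    gaussIndex y h = (gaussIndex x g).swap ↔ y = x.swap ∧ h = g := by
  rcases x with i | i <;> rcases y with k | k <;> simp [gaussIndex]

variable [Fintype G] [DecidableEq G]

/-- The coefficient of the identity in the product of the random group algebra elements with the
letters of `w`, the first letter acting first, applied to `V`. -/
def wordPoly : List (ι ⊕ ι) → G → MvPolynomial ((ι × G) ⊕ (ι × G)) ℂ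
  | [], V => if V = 1 then 1 else 0
  | x :: w, V => (((Real.sqrt (Fintype.card G))⁻¹ : ℝ) : ℂ) •
      ∑ g : G, X (gaussIndex x g) * wordPoly w (letterVal x g * V)

/-- The Wick product records the open letters. Since `X j * W(S) = W(j :: S) + ∂_{j.swap} W(S)`, a
new letter either opens or is paired with one in `S`, as in the recursion of `pairingSum`. Nonempty
Wick products have expectation `0`, which forces all letters to be closed at the end. -/
theorem expectEval_wordPoly_mul_wickProduct [Fintype ι] [DecidableEq ι] {Z : ι × G → Ω → ℂ}
    (hZ : ∀ k, IsStdComplexGaussian (Z k) P) (hind : iIndepFun Z P)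
    (w : List (ι ⊕ ι)) (S : List ((ι ⊕ ι) × G)) (V : G) :
    expectEval P (withConj Z) (withConj_mem_finiteMoments hZ)
      (wordPoly w V * wickProduct (S.map fun s => gaussIndex s.1 s.2)) =
      ((((Real.sqrt (Fintype.card G))⁻¹) ^ S.length * pairingSum w S V : ℝ) : ℂ) := by
  set c : ℝ := (Real.sqrt (Fintype.card G))⁻¹ with hc
  set E := expectEval P (withConj Z) (withConj_mem_finiteMoments hZ) with hE
  have hcc : c * c = (Fintype.card G : ℝ)⁻¹ := by
    rw [hc, ← mul_inv, Real.mul_self_sqrt (Nat.cast_nonneg _)]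
  have hc0 : c ≠ 0 := by
    intro h
    rw [h, mul_zero] at hcc
    exact (inv_ne_zero (Nat.cast_ne_zero.2 Fintype.card_ne_zero)) hcc.symm
  induction w generalizing S V with
  | nil =>
    have := expectEval_wickProduct hZ hind (S.map fun s => gaussIndex s.1 s.2)
    by_cases hV : V = 1 <;> by_cases hS : S = [] <;>
      simp_all [wordPoly, pairingSum]
  | cons x w ih =>
    have hterm : ∀ g : G, E (X (gaussIndex x g) * wordPoly w (letterVal x g * V) *
          wickProduct (S.map fun s => gaussIndex s.1 s.2)) =
        ((c ^ (S.length + 1) * pairingSum w ((x, g) :: S) (letterVal x g * V) : ℝ) : ℂ) +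
        splitSum S fun A t B => if t.1 = x.swap ∧ t.2 = g then
          ((c ^ (A ++ B).length * pairingSum w (A ++ B) (letterVal x g * V) : ℝ) : ℂ) else 0 := by
      intro g
      have e1 : X (gaussIndex x g) * wordPoly w (letterVal x g * V) *
          wickProduct (S.map fun s => gaussIndex s.1 s.2) =
          wordPoly w (letterVal x g * V) *
            wickProduct (((x, g) :: S).map fun s => gaussIndex s.1 s.2) +
          AddMonoidHom.mulLeft (wordPoly w (letterVal x g * V))
            (pderiv (gaussIndex x g).swap (wickProduct (S.map fun s => gaussIndex s.1 s.2))) := by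
        simp only [List.map_cons, wickProduct, AddMonoidHom.coe_mulLeft]
        ring
      rw [e1, map_add, ih, pderiv_wickProduct, splitSum_map, splitSum_map_hom, splitSum_map_hom]
      congr 1
      refine splitSum_congr _ _ _ fun A t B _ => ?_
      simp only [gaussIndex_eq_swap_iff]
      split_ifs with h
      · rw [AddMonoidHom.coe_mulLeft, ← List.map_append, ih]
      · simp
    have e0 : wordPoly (x :: w) V * wickProduct (S.map fun s => gaussIndex s.1 s.2) =
        (c : ℂ) • ∑ g : G, X (gaussIndex x g) * wordPoly w (letterVal x g * V) *
          wickProduct (S.map fun s => gaussIndex s.1 s.2) := by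
      simp only [wordPoly, smul_mul_assoc, Finset.sum_mul, hc]
    rw [e0, map_smul, map_sum, Finset.sum_congr rfl fun g _ => hterm g, Finset.sum_add_distrib,
      splitSum_finsetSum, smul_eq_mul, mul_add, pairingSum, mul_add, Complex.ofReal_add]
    congr 1
    -- Opening yields two extra factors `c`, one from the matrix and one from the longer list, and
    -- `c * c = |G|⁻¹` turns the sum over `g` into an average.
    · rw [Fintype.expect_eq_sum_div_card, ← Complex.ofReal_sum, ← Complex.ofReal_mul,
        ← Finset.mul_sum, div_eq_inv_mul, ← hcc]
      congr 1
      ring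
    · have h1 := splitSum_map_hom (AddMonoidHom.mulLeft (c : ℂ)) S fun A t B => ∑ g : G,
        if t.1 = x.swap ∧ t.2 = g then
          ((c ^ (A ++ B).length * pairingSum w (A ++ B) (letterVal x g * V) : ℝ) : ℂ) else 0
      have h2 := splitSum_map_hom (Complex.ofRealHom.toAddMonoidHom.comp
        (AddMonoidHom.mulLeft (c ^ S.length))) S fun A t B =>
          if t.1 = x.swap then pairingSum w (A ++ B) (letterVal x t.2 * V) else 0
      simp only [AddMonoidHom.coe_mulLeft, AddMonoidHom.coe_comp, Function.comp_apply,
        RingHom.toAddMonoidHom_eq_coe, AddMonoidHom.coe_coe, Complex.ofRealHom_eq_coe] at h1 h2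
      rw [h1, h2]
      refine splitSum_congr _ _ _ fun A t B e => ?_
      by_cases ht : t.1 = x.swap
      · have hl : S.length = (A ++ B).length + 1 := by simp [e]; ring
        simp only [ht, true_and, Finset.sum_ite_eq, Finset.mem_univ, if_true, hl, pow_succ]
        push_cast
        ring
      · simp [ht]

end Wick

/-! ### Traces of words in the random convolution matrices. -/

section Trace

variable {ι G Ω : Type*} [Group G] [Fintype G] [DecidableEq G]

/-- The matrix of left translation by `V`. -/
def translationMatrix (V : G) : Matrix G G ℂ := convMatrix (Pi.single V 1)

theorem translationMatrix_mul (V W : G) :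
    translationMatrix V * translationMatrix W = translationMatrix (V * W) := by
  ext h g
  simp only [translationMatrix, convMatrix, Matrix.mul_apply, Matrix.of_apply, Pi.single_apply]
  rw [Finset.sum_eq_single (W * g)]
  · have : h * (W * g)⁻¹ = V ↔ h * g⁻¹ = V * W := by
      simp only [mul_inv_eq_iff_eq_mul, mul_assoc]
    simp only [this, mul_inv_cancel_right, if_true, mul_one]
  · intro b _ hb
    simp [mul_inv_eq_iff_eq_mul, hb]
  · simp

theorem trace_translationMatrix (V : G) :
    (translationMatrix V).trace = if V = 1 then (Fintype.card G : ℂ) else 0 := by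
  simp only [Matrix.trace, Matrix.diag, translationMatrix, convMatrix, Matrix.of_apply,
    mul_inv_cancel, Pi.single_apply, Finset.sum_const]
  by_cases h : V = 1 <;> simp [h, eq_comm]

theorem withAdjoints_normConv (X : ι → G → Ω → ℂ) (x : ι ⊕ ι) (ω : Ω) :
    withAdjoints (fun i => normConv (X i)) x ω =
      (((Real.sqrt (Fintype.card G))⁻¹ : ℝ) : ℂ) • ∑ g : G,
        withConj (fun p : ι × G => X p.1 p.2) ω (gaussIndex x g) •
          translationMatrix (letterVal x g) := by
  rcases x with i | i
  · simp only [withAdjoints, Sum.elim_inl, normConv]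
    congr 1
    ext h g
    simp [convMatrix, Matrix.sum_apply, translationMatrix, Pi.single_apply, letterVal, gaussIndex,
      withConj]
  · simp only [withAdjoints, Sum.elim_inr, Pi.star_apply, normConv, Matrix.star_eq_conjTranspose,
      Matrix.conjTranspose_smul]
    congr 1
    · simp
    · ext h g
      simp only [convMatrix, Matrix.sum_apply, translationMatrix, Pi.single_apply, letterVal,
        gaussIndex, withConj, Matrix.conjTranspose_apply, Matrix.of_apply, Matrix.smul_apply,
        Sum.map_inr, Sum.elim_inr, smul_eq_mul, mul_ite, mul_one, mul_zero]
      rw [Finset.sum_eq_single (g * h⁻¹)]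
      · simp
      · intro b _ hb
        rw [if_neg]
        intro e
        exact hb (by rw [← inv_inv b, ← e]; simp)
      · exact fun h' => absurd (Finset.mem_univ _) h'

/-- The rightmost matrix is absorbed first into the translation by `V`; hence the reversal of `w`.
-/
theorem trace_word_mul_translationMatrix (X : ι → G → Ω → ℂ) (w : List (ι ⊕ ι)) (V : G) (ω : Ω) :
    ((w.reverse.map fun x => withAdjoints (fun i => normConv (X i)) x ω).prod *
        translationMatrix V).trace =
      Fintype.card G *
        MvPolynomial.eval (withConj (fun p : ι × G => X p.1 p.2) ω) (wordPoly w V) := by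
  induction w generalizing V with
  | nil => by_cases hV : V = 1 <;> simp [trace_translationMatrix, wordPoly, hV]
  | cons x w ih =>
    simp only [List.reverse_cons, List.map_append, List.prod_append, List.map_cons, List.map_nil,
      List.prod_cons, List.prod_nil, mul_one]
    rw [mul_assoc, withAdjoints_normConv, smul_mul_assoc, Finset.sum_mul, Matrix.mul_smul,
      Finset.mul_sum, Matrix.trace_smul, Matrix.trace_sum]
    simp only [smul_mul_assoc, Matrix.mul_smul, Matrix.trace_smul, translationMatrix_mul, ih,
      wordPoly, MvPolynomial.smul_eval, map_sum, map_mul, MvPolynomial.eval_X, smul_eq_mul,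
      Finset.mul_sum]
    refine Finset.sum_congr rfl fun g _ => ?_
    ring

/-- The moments of the random convolution matrices are sums over pairings. -/
theorem meanTrace_word [MeasurableSpace Ω] [Fintype ι] [DecidableEq ι] {P : Measure Ω}
    [IsProbabilityMeasure P]
    {X : ι → G → Ω → ℂ} (hX : ∀ i g, IsStdComplexGaussian (X i g) P)
    (hind : iIndepFun (fun p : ι × G => X p.1 p.2) P) (w : List (ι ⊕ ι)) :
    meanTrace P (fun ω => (w.map fun x => withAdjoints (fun i => normConv (X i)) x ω).prod) =
      (pairingSum w.reverse [] (1 : G) : ℝ) := by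
  have h1 : translationMatrix (1 : G) = 1 := by
    ext h g
    simp [translationMatrix, convMatrix, Pi.single_apply, mul_inv_eq_one, Matrix.one_apply]
  have h2 := expectEval_wordPoly_mul_wickProduct (fun p : ι × G => hX p.1 p.2) hind w.reverse [] 1
  have h3 : ∀ ω, ((w.map fun x => withAdjoints (fun i => normConv (X i)) x ω).prod).trace =
      Fintype.card G * MvPolynomial.eval (withConj (fun p : ι × G => X p.1 p.2) ω)
        (wordPoly w.reverse 1) := by
    intro ω
    have := trace_word_mul_translationMatrix X w.reverse 1 ω
    rwa [h1, mul_one, List.reverse_reverse] at this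
  simp only [meanTrace, h3]
  rw [integral_const_mul, ← mul_assoc, inv_mul_cancel₀, one_mul]
  · simpa [wickProduct, expectEval] using h2
  · exact_mod_cast Fintype.card_ne_zero

theorem entry_mem_finiteMoments [MeasurableSpace Ω] {P : Measure Ω}
    [IsProbabilityMeasure P]
    {X : ι → G → Ω → ℂ} (hX : ∀ i g, IsStdComplexGaussian (X i g) P)
    (Q : FreeAlgebra ℂ (ι ⊕ ι)) (h g : G) :
    (fun ω => FreeAlgebra.lift ℂ (withAdjoints fun i => normConv (X i)) Q ω h g) ∈
      finiteMoments P := by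
  induction Q using FreeAlgebra.induction generalizing h g with
  | grade0 r =>
    simp only [AlgHom.commutes, Pi.algebraMap_apply, Matrix.algebraMap_matrix_apply]
    exact (finiteMoments P).algebraMap_mem _
  | grade1 x =>
    simp only [FreeAlgebra.lift_ι_apply]
    have hn : ∀ i h g, (fun ω => normConv (X i) ω h g) ∈ finiteMoments P := fun i h g =>
      Subalgebra.smul_mem _ (hX i (h * g⁻¹)).mem_finiteMoments _
    rcases x with i | i
    · exact hn i h g
    · have := Subalgebra.smul_mem _ (hX i (g * h⁻¹)).star_mem_finiteMoments
        (((Real.sqrt (Fintype.card G))⁻¹ : ℝ) : ℂ)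
      convert this using 1
      ext ω
      simp [withAdjoints, normConv, convMatrix]
  | mul a b ha hb =>
    simp only [map_mul, Pi.mul_apply, Matrix.mul_apply]
    exact sum_mem_finiteMoments _ fun k _ => mul_mem (ha h k) (hb k g)
  | add a b ha hb =>
    simp only [map_add, Pi.add_apply, Matrix.add_apply]
    exact add_mem (ha h g) (hb h g)

theorem integrable_trace_lift [MeasurableSpace Ω] {P : Measure Ω}
    [IsProbabilityMeasure P]
    {X : ι → G → Ω → ℂ} (hX : ∀ i g, IsStdComplexGaussian (X i g) P)
    (Q : FreeAlgebra ℂ (ι ⊕ ι)) :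
    Integrable (fun ω => (FreeAlgebra.lift ℂ
        (withAdjoints fun i => normConv (X i)) Q ω).trace) P :=
  integrable_of_mem_finiteMoments
    (sum_mem_finiteMoments _ fun g _ => entry_mem_finiteMoments hX Q g g)

end Trace

/-! ### Orthogonality of characters and finiteness of the dual. -/

section UnitaryDual

variable {G : Type*} [Group G]

theorem unitaryToRep_apply {n : ℕ} (ρ : G →* Matrix.unitaryGroup (Fin n) ℂ) (g : G)
    (x : Fin n → ℂ) : unitaryToRep ρ g x = (ρ g : Matrix (Fin n) (Fin n) ℂ).mulVec x := rfl

/-- The character of a class of irreducible representations. -/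
def RandomConvolution.UnitaryDual.character (Λ : UnitaryDual G) (g : G) : ℂ :=
  (unitaryToRep Λ.2.out.1).character g

theorem UnitaryDual.eq_of_equiv {Λ Λ' : UnitaryDual G}
    (h : Nonempty ((unitaryToRep Λ.2.out.1).Equiv (unitaryToRep Λ'.2.out.1))) : Λ = Λ' := by
  obtain ⟨n, q⟩ := Λ
  obtain ⟨n', q'⟩ := Λ'
  obtain ⟨e⟩ := h
  have hn : n = n' := by
    have := e.toLinearEquiv.finrank_eq
    simpa using this
  subst hn
  congr 1
  rw [← Quotient.out_eq q, ← Quotient.out_eq q']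
  exact Quotient.sound ⟨e⟩

variable [Fintype G]

theorem UnitaryDual.character_orthonormal [DecidableEq (UnitaryDual G)] (Λ Λ' : UnitaryDual G) :
    (Nat.card G : ℂ)⁻¹ * ∑ g : G, Λ.character g * Λ'.character g⁻¹ = if Λ' = Λ then 1 else 0 := by
  have : Invertible (Nat.card G : ℂ) := invertibleOfNonzero (by simp)
  have : (unitaryToRep Λ.2.out.1).IsIrreducible := Λ.2.out.2
  have : (unitaryToRep Λ'.2.out.1).IsIrreducible := Λ'.2.out.2
  have := Representation.char_orthonormal (unitaryToRep Λ.2.out.1) (unitaryToRep Λ'.2.out.1)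
  refine this.trans ?_
  by_cases h : Λ' = Λ
  · subst h
    rw [if_pos rfl, if_pos ⟨Representation.Equiv.refl _⟩]
  · rw [if_neg h, if_neg fun e => h (UnitaryDual.eq_of_equiv e)]

theorem UnitaryDual.linearIndependent_character :
    LinearIndependent ℂ (UnitaryDual.character : UnitaryDual G → G → ℂ) := by
  classical
  rw [linearIndependent_iff']
  intro s c hc Λ hΛ
  have h (Λ' : UnitaryDual G) : (Nat.card G : ℂ)⁻¹ *
      ∑ g : G, (∑ i ∈ s, c i • i.character) g * Λ'.character g⁻¹ =
      ∑ i ∈ s, c i * ((Nat.card G : ℂ)⁻¹ * ∑ g : G, i.character g * Λ'.character g⁻¹) := by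
    simp only [Finset.sum_apply, Pi.smul_apply, smul_eq_mul, Finset.sum_mul, Finset.mul_sum]
    rw [Finset.sum_comm]
    refine Finset.sum_congr rfl fun i _ => Finset.sum_congr rfl fun g _ => by ring
  have := h Λ
  simp only [hc, UnitaryDual.character_orthonormal] at this
  simpa [hΛ] using this.symm

instance : Finite (UnitaryDual G) :=
  UnitaryDual.linearIndependent_character.finite

end UnitaryDual

/-! ### Completeness of characters: at most `|Ĝ|` conjugacy classes. -/

section Completeness

variable {G : Type*} [Group G]

theorem apply_apply_of_mul {V : Type*} [NormedAddCommGroup V] [InnerProductSpace ℂ V]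
    (R : G →* (V ≃ₗᵢ[ℂ] V)) (g h : G) (v : V) : R g (R h v) = R (g * h) v := by
  rw [map_mul]; rfl

theorem apply_apply_inv {V : Type*} [NormedAddCommGroup V] [InnerProductSpace ℂ V]
    (R : G →* (V ≃ₗᵢ[ℂ] V)) (g : G) (v : V) : R g (R g⁻¹ v) = v := by
  rw [apply_apply_of_mul, mul_inv_cancel, map_one]; rfl

/-- A minimal nonzero invariant subspace of `U` is irreducible, and an orthonormal basis of it gives
unitary matrices, as membership in `UnitaryDual` demands. -/
theorem exists_unitary_irrep {V : Type*} [NormedAddCommGroup V] [InnerProductSpace ℂ V]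
    [FiniteDimensional ℂ V] (R : G →* (V ≃ₗᵢ[ℂ] V)) (U : Submodule ℂ V) (hU : U ≠ ⊥)
    (hinv : ∀ g, ∀ v ∈ U, R g v ∈ U) :
    ∃ (n : ℕ+) (ρ : IrrepOfDim G n) (e : (Fin n → ℂ) →ₗ[ℂ] V), Function.Injective e ∧
      (∀ x, e x ∈ U) ∧ ∀ g x, e (unitaryToRep ρ.1 g x) = R g (e x) := by
  obtain ⟨W, ⟨hW0, hWU, hWinv⟩, hmin⟩ := (wellFounded_lt (α := Submodule ℂ V)).has_min
    {W | W ≠ ⊥ ∧ W ≤ U ∧ ∀ g, ∀ v ∈ W, R g v ∈ W} ⟨U, hU, le_rfl, hinv⟩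
  have hpos : 0 < Module.finrank ℂ W := by
    rw [Module.finrank_pos_iff, Submodule.nontrivial_iff_ne_bot]
    exact hW0
  let r : Representation ℂ G W :=
    { toFun := fun g => (R g).toLinearEquiv.toLinearMap.restrict (hWinv g)
      map_one' := by ext; simp
      map_mul' := fun g h => by ext; simp }
  have hr : ∀ g v, (r g v : V) = R g v := fun g v => rfl
  let b := stdOrthonormalBasis ℂ W
  have hadj : ∀ g, star (r g) = r g⁻¹ := by
    intro g
    rw [LinearMap.star_eq_adjoint, eq_comm, LinearMap.eq_adjoint_iff]
    intro x y
    rw [Submodule.coe_inner, Submodule.coe_inner, hr, hr, ← (R g).inner_map_map,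
      apply_apply_inv]
  let M := LinearMap.toMatrixOrthonormal b
  let ρ : G →* Matrix.unitaryGroup (Fin (Module.finrank ℂ W)) ℂ :=
    MonoidHom.codRestrict ((M : _ →* Matrix (Fin (Module.finrank ℂ W)) _ ℂ).comp r)
      (Matrix.unitaryGroup (Fin (Module.finrank ℂ W)) ℂ) (by
        intro g
        rw [Matrix.mem_unitaryGroup_iff]
        change M (r g) * star (M (r g)) = 1
        rw [← map_star, hadj, ← map_mul, ← map_mul]
        simp)
  let e : (Fin (Module.finrank ℂ W) → ℂ) →ₗ[ℂ] V :=
    W.subtype ∘ₗ b.toBasis.equivFun.symm.toLinearMap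
  have he : Function.Injective e := W.injective_subtype.comp (LinearEquiv.injective _)
  have heW : ∀ x, e x ∈ W := fun x => Subtype.property _
  have heq : ∀ g x, e (unitaryToRep ρ g x) = R g (e x) := by
    intro g x
    change ((b.toBasis.equivFun.symm (unitaryToRep ρ g x) : W) : V) =
      (r g (b.toBasis.equivFun.symm x) : W)
    congr 1
    rw [LinearEquiv.symm_apply_eq, unitaryToRep_apply]
    have := LinearMap.toMatrix_mulVec_repr b.toBasis b.toBasis (r g) (b.toBasis.equivFun.symm x)
    rw [← Module.Basis.equivFun_apply, LinearEquiv.apply_symm_apply] at this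
    exact this
  have hirr : (unitaryToRep ρ).IsIrreducible := by
    refine { exists_pair_ne := ⟨⊥, ⊤, ?_⟩, eq_bot_or_eq_top := ?_ }
    · intro h
      have := congrArg Subrepresentation.toSubmodule h
      have h' : (⊥ : Submodule ℂ (Fin (Module.finrank ℂ W) → ℂ)) = ⊤ := this
      have : Nonempty (Fin (Module.finrank ℂ W)) := ⟨⟨0, hpos⟩⟩
      exact bot_ne_top h'
    · intro S
      by_cases hS : S.toSubmodule = ⊥
      · left
        exact Subrepresentation.toSubmodule_injective hS
      · right
        have hle : S.toSubmodule.map e ≤ W := by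
          rintro _ ⟨x, -, rfl⟩
          exact heW x
        have hne : ¬ S.toSubmodule.map e < W := by
          refine hmin _ ⟨?_, hle.trans hWU, ?_⟩
          · rwa [Ne, ← Submodule.map_bot e, (Submodule.map_injective_of_injective he).eq_iff]
          · rintro g _ ⟨x, hx, rfl⟩
            exact ⟨_, S.apply_mem_toSubmodule g hx, heq g x⟩
        have hEq : S.toSubmodule.map e = W := by
          by_contra h
          exact hne (lt_of_le_of_ne hle h)
        apply Subrepresentation.toSubmodule_injective
        change S.toSubmodule = ⊤
        rw [eq_top_iff]
        intro x _
        have : e x ∈ S.toSubmodule.map e := by rw [hEq]; exact heW x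
        obtain ⟨y, hy, hxy⟩ := this
        rwa [← he hxy]
  exact ⟨⟨_, hpos⟩, ⟨ρ, hirr⟩, e, he, fun x => hWU (heW x), heq⟩

variable [Fintype G]

/-- By Schur's lemma, a class function orthogonal to all characters vanishes in every irreducible
representation. -/
theorem sum_smul_unitaryToRep_eq_zero (F : G → ℂ) (hF : ∀ g h, F (h * g * h⁻¹) = F g)
    (h0 : ∀ Λ : UnitaryDual G, ∑ g, F g * Λ.character g = 0) {n : ℕ+} (ρ : IrrepOfDim G n) :
    ∑ g, F g • unitaryToRep ρ.1 g = 0 := by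
  have : (unitaryToRep ρ.1).IsIrreducible := ρ.2
  let A : Representation.IntertwiningMap (unitaryToRep ρ.1) (unitaryToRep ρ.1) :=
    ⟨∑ g, F g • unitaryToRep ρ.1 g, by
      intro h
      change (∑ g, F g • unitaryToRep ρ.1 g) * unitaryToRep ρ.1 h =
        unitaryToRep ρ.1 h * ∑ g, F g • unitaryToRep ρ.1 g
      rw [Finset.sum_mul, Finset.mul_sum]
      refine Fintype.sum_bijective (fun g => h⁻¹ * g * h) ?_ _ _ fun g => ?_
      · exact (Group.mulRight_bijective h).comp (Group.mulLeft_bijective h⁻¹)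
      · have := hF g h⁻¹
        rw [inv_inv] at this
        rw [smul_mul_assoc, mul_smul_comm, ← map_mul, ← map_mul, this]
        congr 2
        group⟩
  obtain ⟨c, hc⟩ :=
    (Representation.IsIrreducible.algebraMap_intertwiningMap_bijective_of_isAlgClosed
      (ρ := unitaryToRep ρ.1)).2 A
  have hA : ∑ g, F g • unitaryToRep ρ.1 g = c • LinearMap.id := by
    have := congrArg (fun B => B.toLinearMap) hc
    exact this.symm
  have hχ : ∑ g, F g * (unitaryToRep ρ.1).character g = 0 := by
    let Λ : UnitaryDual G := ⟨n, ⟦ρ⟧⟩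
    obtain ⟨e⟩ : Nonempty ((unitaryToRep Λ.2.out.1).Equiv (unitaryToRep ρ.1)) :=
      Quotient.exact (Quotient.out_eq Λ.2)
    rw [← Representation.char_iso e]
    exact h0 Λ
  have htr := congrArg (LinearMap.trace ℂ _) hA
  rw [map_sum, map_smul] at htr
  simp only [map_smul, smul_eq_mul] at htr
  rw [show (∑ g, F g * LinearMap.trace ℂ _ (unitaryToRep ρ.1 g)) = 0 from hχ] at htr
  have hc0 : c = 0 := by simpa using htr.symm
  rw [hA, hc0, zero_smul]

/-- The left regular representation on `ℓ²(G)`. -/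
def leftRegularIsometry (G : Type*) [Group G] [Fintype G] :
    G →* (EuclideanSpace ℂ G ≃ₗᵢ[ℂ] EuclideanSpace ℂ G) where
  toFun g := LinearIsometryEquiv.piLpCongrLeft 2 ℂ ℂ (Equiv.mulLeft g)
  map_one' := by
    ext v h
    simp only [LinearIsometryEquiv.piLpCongrLeft_apply, Equiv.piCongrLeft'_apply]
    exact congrArg v ((Equiv.symm_apply_eq _).2 (one_mul h).symm)
  map_mul' a b := by
    ext v h
    simp only [LinearIsometryEquiv.piLpCongrLeft_apply, Equiv.piCongrLeft'_apply]
    refine congrArg v ?_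
    simp [Equiv.symm_apply_eq]

theorem leftRegularIsometry_apply (g h : G) (v : EuclideanSpace ℂ G) :
    leftRegularIsometry G g v h = v (g⁻¹ * h) := by
  simp [leftRegularIsometry, LinearIsometryEquiv.piLpCongrLeft_apply, Equiv.piCongrLeft']

/-- The operator `∑ F g • R g` on the regular representation kills every irreducible subspace, hence
everything, and its value at the unit mass at `1` is `F`. -/
theorem eq_zero_of_sum_character_eq_zero (F : G → ℂ) (hF : ∀ g h, F (h * g * h⁻¹) = F g)
    (h0 : ∀ Λ : UnitaryDual G, ∑ g, F g * Λ.character g = 0) : F = 0 := by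
  classical
  let R := leftRegularIsometry G
  let A : EuclideanSpace ℂ G →ₗ[ℂ] EuclideanSpace ℂ G :=
    ∑ g, F g • (R g).toLinearEquiv.toLinearMap
  have hA : ∀ v, A v = ∑ g, F g • R g v := fun v => by simp [A, LinearMap.sum_apply]
  have hcomm : ∀ h v, A (R h v) = R h (A v) := by
    intro h v
    rw [hA, hA, map_sum]
    refine Fintype.sum_bijective (fun g => h⁻¹ * g * h) ?_ _ _ fun g => ?_
    · exact (Group.mulRight_bijective h).comp (Group.mulLeft_bijective h⁻¹)
    · have := hF g h⁻¹
      rw [inv_inv] at this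
      rw [map_smul, this, apply_apply_of_mul, apply_apply_of_mul]
      congr 3
      group
  -- This complement is invariant; were it nonzero, it would contain an irreducible copy, which lies
  -- in the kernel too.
  have hker : (LinearMap.ker A)ᗮ = ⊥ := by
    by_contra hne
    obtain ⟨n, ρ, e, he, heU, heq⟩ := exists_unitary_irrep R _ hne (by
      intro g v hv
      rw [Submodule.mem_orthogonal] at hv ⊢
      intro u hu
      have := hv (R g⁻¹ u) (by
        rw [LinearMap.mem_ker] at hu ⊢
        rw [hcomm, hu, map_zero])
      rwa [← (R g).inner_map_map, apply_apply_inv] at this)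
    have hz := sum_smul_unitaryToRep_eq_zero F hF h0 ρ
    have hmem : ∀ x, e x ∈ LinearMap.ker A := by
      intro x
      rw [LinearMap.mem_ker, hA]
      have := congrArg e (LinearMap.congr_fun hz x)
      simpa [LinearMap.sum_apply, heq] using this
    have hx : ∀ x, e x = 0 := fun x => by
      have : e x ∈ LinearMap.ker A ⊓ (LinearMap.ker A)ᗮ := ⟨hmem x, heU x⟩
      rwa [Submodule.inf_orthogonal_eq_bot, Submodule.mem_bot] at this
    have : (Pi.single ⟨0, n.2⟩ 1 : Fin n → ℂ) = 0 := he (by rw [hx, map_zero])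
    exact one_ne_zero ((Pi.single_eq_same _ _).symm.trans (congrFun this _))
  have htop : LinearMap.ker A = ⊤ := Submodule.orthogonal_eq_bot_iff.1 hker
  ext h
  have h1 : A (EuclideanSpace.single 1 1) = 0 := by
    rw [← LinearMap.mem_ker, htop]; trivial
  have h2 := congrArg (fun v : EuclideanSpace ℂ G => v h) h1
  simp only [hA] at h2
  simpa [R, leftRegularIsometry_apply, inv_mul_eq_one, Pi.single_apply] using h2

/-- Pairing with characters is injective on class functions, so dimensions can be compared. -/
theorem card_conjClasses_le_card_unitaryDual :
    Nat.card (ConjClasses G) ≤ Nat.card (UnitaryDual G) := by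
  have : Fintype (UnitaryDual G) := Fintype.ofFinite _
  have : Fintype (ConjClasses G) := Fintype.ofFinite _
  let T : (ConjClasses G → ℂ) →ₗ[ℂ] (UnitaryDual G → ℂ) :=
    { toFun := fun f Λ => ∑ g, f (ConjClasses.mk g) * Λ.character g
      map_add' := fun f f' => by ext Λ; simp [add_mul, Finset.sum_add_distrib]
      map_smul' := fun c f => by ext Λ; simp [mul_assoc, Finset.mul_sum] }
  have hT : Function.Injective T := by
    rw [injective_iff_map_eq_zero]
    intro f hf
    have := eq_zero_of_sum_character_eq_zero (fun g => f (ConjClasses.mk g)) (fun g h => by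
      congr 1
      exact ConjClasses.mk_eq_mk_iff_isConj.2 (isConj_iff.2 ⟨h⁻¹, by group⟩))
      (fun Λ => congrFun hf Λ)
    ext c
    obtain ⟨g, rfl⟩ := ConjClasses.exists_rep c
    exact congrFun this g
  have := LinearMap.finrank_le_finrank_of_injective hT
  simpa [Nat.card_eq_fintype_card] using this

theorem commRatio_eq [DecidableEq G] :
    commRatio G = Nat.card (ConjClasses G) / Nat.card G := by
  have h : ((commProb G : ℚ) : ℝ) = Nat.card (ConjClasses G) / Nat.card G := by
    rw [commProb_def']; push_cast; rfl
  rw [← h, commProb_def, commRatio, Fintype.expect_eq_sum_div_card, Finset.sum_boole,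
    Nat.subtype_card (Finset.univ.filter fun p : G × G =>
      p.1 * p.2 = p.2 * p.1) (by simp [Commute, SemiconjBy])]
  simp [sq]

end Completeness

/-! ### The commuting probability is controlled by the Plancherel measure. -/

section Plancherel

/-- The function `n ↦ 1 / n²` on `{1, 2, …} ∪ {∞}`. -/
def invSq : BoundedContinuousFunction (OnePoint ℕ+) ℝ :=
  BoundedContinuousFunction.mkOfCompact
    ⟨fun x => x.elim 0 fun n => ((n : ℝ) ^ 2)⁻¹, by
      rw [OnePoint.continuous_iff_from_discrete]
      have h1 : Tendsto (fun n : ℕ+ => (n : ℕ)) cofinite atTop := by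
        rw [← Nat.cofinite_eq_atTop]
        exact PNat.coe_injective.tendsto_cofinite
      exact (tendsto_pow_atTop two_ne_zero |>.comp
        (tendsto_natCast_atTop_atTop.comp h1)).inv_tendsto_atTop⟩

@[simp] theorem invSq_coe (n : ℕ+) : invSq (n : OnePoint ℕ+) = ((n : ℝ) ^ 2)⁻¹ := rfl

@[simp] theorem invSq_infty : invSq (OnePoint.infty : OnePoint ℕ+) = 0 := rfl

variable {G : Type*} [Group G] [Fintype G]

/-- The weight `(dim Λ)² / |G|` cancels `1 / (dim Λ)²`, so each class counts `1 / |G|`. -/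
theorem integral_invSq_plancherelDim [DecidableEq G] :
    ∫ x, invSq x ∂(plancherelDim G) = Nat.card (UnitaryDual G) / Nat.card G := by
  have : Fintype (UnitaryDual G) := Fintype.ofFinite _
  rw [plancherelDim, integral_map (Measurable.of_discrete).aemeasurable
    invSq.continuous.stronglyMeasurable.aestronglyMeasurable, plancherel, Measure.sum_fintype,
    integral_finsetSum_measure]
  · have h : ∀ Λ : UnitaryDual G, ∫ x, invSq (x.dim : OnePoint ℕ+)
        ∂((((Λ.dim : ℕ) : ENNReal) ^ 2 / (Fintype.card G : ENNReal)) • Measure.dirac Λ) =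
        (Fintype.card G : ℝ)⁻¹ := by
      intro Λ
      rw [integral_smul_measure, integral_dirac]
      have : ((Λ.dim : ℕ) : ℝ) ≠ 0 := by simp
      simp only [invSq_coe, ENNReal.toReal_div, ENNReal.toReal_pow, ENNReal.toReal_natCast,
        smul_eq_mul]
      field_simp
    rw [Finset.sum_congr rfl fun Λ _ => h Λ]
    simp [Nat.card_eq_fintype_card, div_eq_mul_inv]
  · intro Λ _
    refine Integrable.smul_measure (integrable_dirac enorm_lt_top) ?_
    exact ENNReal.div_ne_top (ENNReal.pow_ne_top (ENNReal.natCast_ne_top _))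
      (Nat.cast_ne_zero.2 Fintype.card_ne_zero)

theorem tendsto_commRatio {G : ℕ → Type*} [∀ N, Group (G N)] [∀ N, Fintype (G N)]
    [∀ N, DecidableEq (G N)]
    (hμ : WeaklyConverges (fun N => plancherelDim (G N))
      (Measure.dirac (OnePoint.infty : OnePoint ℕ+))) :
    Tendsto (fun N => commRatio (G N)) atTop (𝓝 0) := by
  have h := hμ invSq
  rw [integral_dirac' _ _ invSq.continuous.stronglyMeasurable] at h
  simp only [integral_invSq_plancherelDim] at h
  refine squeeze_zero (fun N => commRatio_nonneg) (fun N => ?_) h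
  rw [commRatio_eq]
  gcongr
  exact card_conjClasses_le_card_unitaryDual

end Plancherel

/-! ### Nonnegative walks and Catalan numbers. -/

section Catalan

/-- The number of walks with `k` steps `±1` and total displacement `d`. -/
def walkCount : ℕ → ℤ → ℤ
  | 0, d => if d = 0 then 1 else 0
  | k + 1, d => walkCount k (d - 1) + walkCount k (d + 1)

theorem walkCount_neg (k : ℕ) (d : ℤ) : walkCount k (-d) = walkCount k d := by
  induction k generalizing d with
  | zero => simp [walkCount]
  | succ k ih =>
    simp only [walkCount]
    rw [← ih (d - 1), ← ih (d + 1), add_comm]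
    congr 2 <;> ring

theorem walkCount_of_lt (k : ℕ) (d : ℤ) (h : k < d) : walkCount k d = 0 := by
  induction k generalizing d with
  | zero => simp only [walkCount, ite_eq_right_iff]; push_cast at h; omega
  | succ k ih =>
    simp only [walkCount]
    push_cast at h
    rw [ih _ (by omega), ih _ (by omega), add_zero]

theorem walkCount_of_odd (k : ℕ) (d : ℤ) (h : Odd (k + d)) : walkCount k d = 0 := by
  induction k generalizing d with
  | zero =>
    simp only [walkCount, ite_eq_right_iff]
    rintro rfl
    simp at h
  | succ k ih =>
    simp only [walkCount]
    rw [Int.odd_iff] at h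
    push_cast at h
    rw [ih _ (by rw [Int.odd_iff]; omega), ih _ (by rw [Int.odd_iff]; omega), add_zero]

theorem walkCount_eq_choose (k j : ℕ) : walkCount k (k - 2 * j) = k.choose j := by
  induction k generalizing j with
  | zero =>
    cases j <;> simp [walkCount]
    omega
  | succ k ih =>
    simp only [walkCount]
    have h1 := ih j
    cases j with
    | zero =>
      rw [walkCount_of_lt k (_ + 1) (by push_cast; omega)]
      simpa using h1
    | succ j =>
      have h2 := ih j
      rw [Nat.choose_succ_succ, add_comm]
      push_cast at h1 h2 ⊢
      rw [← h1, ← h2]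
      congr 2 <;> ring

/-- The number of nonnegative walks with `k` steps `±1` from `r` to `0`. -/
def ballotCount : ℕ → ℕ → ℤ
  | 0, r => if r = 0 then 1 else 0
  | k + 1, 0 => ballotCount k 1
  | k + 1, r + 1 => ballotCount k (r + 2) + ballotCount k r

/-- The reflection principle: walks from `r` to `0` that hit `-1` correspond to walks from `r` to
`-2`. In the recursion the boundary case `r = 0` is the symmetry of `walkCount`. -/
theorem ballotCount_eq (k r : ℕ) : ballotCount k r = walkCount k r - walkCount k (r + 2) := by
  induction k generalizing r with
  | zero =>
    have : (r : ℤ) + 2 ≠ 0 := by omega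
    simp [ballotCount, walkCount, this]
  | succ k ih =>
    cases r with
    | zero =>
      have := walkCount_neg k 1
      simp [ballotCount, ih, walkCount, this]
    | succ r =>
      simp only [ballotCount, ih, walkCount]
      push_cast
      ring_nf

theorem ballotCount_odd (n : ℕ) : ballotCount (2 * n + 1) 0 = 0 := by
  rw [ballotCount_eq, walkCount_of_odd, walkCount_of_odd, sub_zero] <;>
  · rw [Int.odd_iff]; push_cast; omega

theorem ballotCount_even (n : ℕ) : ballotCount (2 * n) 0 = catalan n := by
  have h1 := walkCount_eq_choose (2 * n) n
  have h2 : walkCount (2 * n) 2 = (2 * n).choose (n + 1) := by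
    rw [← walkCount_eq_choose, ← walkCount_neg]
    congr 1
    push_cast
    ring
  rw [ballotCount_eq]
  have h3 := Nat.choose_succ_right_eq (2 * n) n
  have h4 := succ_mul_catalan_eq_centralBinom n
  rw [Nat.centralBinom] at h4
  rw [show 2 * n - n = n by omega] at h3
  have e1 : walkCount (2 * n) ((0 : ℕ) : ℤ) = (2 * n).choose n := by
    rw [← h1]; congr 1; push_cast; ring
  rw [e1, Nat.cast_zero, zero_add, h2]
  have hn : ((n : ℤ) + 1) ≠ 0 := by omega
  apply mul_left_cancel₀ hn
  zify at h3 h4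
  rw [mul_sub, h4, mul_comm ((n : ℤ) + 1), mul_comm ((n : ℤ) + 1), h3]
  ring

end Catalan

/-! ### Free semicircular operators on the full Fock space. -/

section Fock

open scoped lp

variable {Y : Type*} [DecidableEq Y]

/-- The full Fock space over `ℂ^Y`. -/
abbrev FockSpace (Y : Type*) := lp (fun _ : List Y => ℂ) 2

/-- The basis vectors of the Fock space. -/
def fockVec (S : List Y) : FockSpace Y := lp.single 2 S (1 : ℂ)

theorem fock_mul_apply {Y : Type*} (a b : FockSpace Y →L[ℂ] FockSpace Y) (v : FockSpace Y) :
    (a * b) v = a (b v) := rfl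

theorem fockVec_apply (S T : List Y) : fockVec S T = if T = S then 1 else 0 := by
  simp [fockVec, Pi.single_apply]

theorem inner_fockVec (S : List Y) (v : FockSpace Y) : inner ℂ (fockVec S) v = v S := by
  simp [fockVec, lp.inner_single_left]

theorem orthonormal_fockVec : Orthonormal ℂ (fockVec : List Y → FockSpace Y) := by
  rw [orthonormal_iff_ite]
  intro S T
  rw [inner_fockVec, fockVec_apply]

/-- The creation operator. -/
def create (y : Y) : FockSpace Y →L[ℂ] FockSpace Y :=
  ((orthonormal_fockVec.comp (List.cons y) List.cons_injective).orthogonalFamily.linearIsometry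
    ).toContinuousLinearMap

theorem create_fockVec (y : Y) (S : List Y) : create y (fockVec S) = fockVec (y :: S) := by
  simp [create, fockVec]

theorem star_create_apply (y : Y) (v : FockSpace Y) (T : List Y) :
    star (create y) v T = v (y :: T) := by
  rw [← inner_fockVec, ContinuousLinearMap.star_eq_adjoint, ContinuousLinearMap.adjoint_inner_right,
    create_fockVec, inner_fockVec]

theorem star_create_fockVec_nil (y : Y) : star (create y) (fockVec []) = 0 := by
  ext T
  simp [star_create_apply, fockVec_apply]

theorem star_create_fockVec_cons (y z : Y) (S : List Y) :
    star (create y) (fockVec (z :: S)) = if z = y then fockVec S else 0 := by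
  ext T
  rw [star_create_apply, fockVec_apply]
  by_cases h : z = y
  · simp [h, fockVec_apply]
  · simp [h, Ne.symm h]

theorem star_create_mul_create (y z : Y) :
    star (create y) * create z = if y = z then 1 else 0 := by
  ext v T
  rw [fock_mul_apply, star_create_apply, ← inner_fockVec,
    ← ContinuousLinearMap.adjoint_inner_left, ← ContinuousLinearMap.star_eq_adjoint,
    star_create_fockVec_cons]
  by_cases h : y = z
  · simp [h, inner_fockVec]
  · simp [h]

/-- The semicircular operators on the Fock space. -/
def fockField (y : Y) : FockSpace Y →L[ℂ] FockSpace Y := create y + star (create y)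

theorem fockField_nil (y : Y) : fockField y (fockVec []) = fockVec [y] := by
  simp [fockField, create_fockVec, star_create_fockVec_nil]

theorem fockField_cons (y z : Y) (S : List Y) : fockField y (fockVec (z :: S)) =
    fockVec (y :: z :: S) + if z = y then fockVec S else 0 := by
  simp [fockField, create_fockVec, star_create_fockVec_cons]

/-- The vacuum state. -/
def vacuum (Y : Type*) [DecidableEq Y] : (FockSpace Y →L[ℂ] FockSpace Y) →ₗ[ℂ] ℂ where
  toFun a := inner ℂ (fockVec []) (a (fockVec []))
  map_add' a b := by simp
  map_smul' c a := by simp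

theorem vacuum_apply (a : FockSpace Y →L[ℂ] FockSpace Y) : vacuum Y a = a (fockVec []) [] :=
  inner_fockVec _ _

theorem isState_vacuum : IsState (vacuum Y) where
  map_one := by simp [vacuum_apply, fockVec_apply]
  map_star a := by
    rw [vacuum_apply, vacuum_apply, ← inner_fockVec, ← inner_fockVec,
      ContinuousLinearMap.star_eq_adjoint, ContinuousLinearMap.adjoint_inner_right,
      ← inner_conj_symm]
    rfl
  nonneg a := by
    rw [vacuum_apply, ← inner_fockVec, fock_mul_apply, ← ContinuousLinearMap.adjoint_inner_left,
      ← ContinuousLinearMap.star_eq_adjoint]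
    exact inner_self_nonneg (𝕜 := ℂ)

theorem isSelfAdjoint_fockField (y : Y) : IsSelfAdjoint (fockField y) :=
  IsSelfAdjoint.add_star_self _

/-- On words in the single letter `y`, the field raises or lowers the length by one, so its powers
count nonnegative walks. -/
theorem fockField_pow_apply (y : Y) (k r : ℕ) :
    (fockField y ^ k) (fockVec (List.replicate r y)) [] = ballotCount k r := by
  induction k generalizing r with
  | zero => cases r <;> simp [ballotCount, fockVec_apply, List.replicate_succ]
  | succ k ih =>
    rw [pow_succ, fock_mul_apply]
    cases r with
    | zero =>
      have := ih 1
      simpa [fockField_nil, ballotCount] using this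
    | succ r =>
      have h1 := ih (r + 2)
      have h2 := ih r
      rw [List.replicate_succ, fockField_cons, if_pos rfl, map_add]
      simp only [List.replicate_succ] at h1
      rw [lp.coeFn_add, Pi.add_apply, h1, h2]
      simp [ballotCount]

theorem isSemicircular_fockField (y : Y) : IsSemicircular (vacuum Y) (fockField y) where
  selfAdjoint := isSelfAdjoint_fockField y
  odd_moment n := by
    have := fockField_pow_apply y (2 * n + 1) 0
    rw [vacuum_apply]
    simpa [ballotCount_odd] using this
  even_moment n := by
    have := fockField_pow_apply y (2 * n) 0
    rw [vacuum_apply]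
    simpa [ballotCount_even] using this

variable {ι : Type*} (p : Y → ι)

/-- The words in the letters of colour `i`. -/
def colourWords (i : ι) : Submodule ℂ (List Y →₀ ℂ) :=
  Finsupp.supported ℂ ℂ {U | ∀ y ∈ U, p y = i}

/-- The vectors that are combinations of words starting with a letter of colour `i`. -/
def colourVecs (i : ι) : Submodule ℂ (FockSpace Y) :=
  Submodule.span ℂ {v | ∃ y T, p y = i ∧ v = fockVec (y :: T)}

/-- A field alters only the initial run of letters of its colour. The essential point is that `u'`
does not depend on the remainder `S`. -/
theorem fockField_colour (y : Y) {u : List Y →₀ ℂ} (hu : u ∈ colourWords p (p y)) :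
    ∃ u' ∈ colourWords p (p y), ∀ S : List Y, (∀ z ∈ S.head?, p z ≠ p y) →
      fockField y (Finsupp.linearCombination ℂ (fun U => fockVec (U ++ S)) u) =
        Finsupp.linearCombination ℂ (fun U => fockVec (U ++ S)) u' := by
  rw [colourWords, Finsupp.supported_eq_span_single] at hu
  induction hu using Submodule.span_induction with
  | mem u hu =>
    obtain ⟨U, hU, rfl⟩ := hu
    have hcons : Finsupp.single (y :: U) (1 : ℂ) ∈ colourWords p (p y) :=
      Finsupp.single_mem_supported _ _ (by
        intro z hz
        rcases List.mem_cons.1 hz with rfl | hz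
        · rfl
        · exact hU z hz)
    cases U with
    | nil =>
      refine ⟨_, hcons, fun S hS => ?_⟩
      cases S with
      | nil => simp [fockField_nil]
      | cons z S =>
        have : z ≠ y := fun h => hS z (by simp) (by rw [h])
        simp [fockField_cons, this]
    | cons z U =>
      refine ⟨Finsupp.single (y :: z :: U) 1 + if z = y then Finsupp.single U 1 else 0,
        add_mem hcons ?_, fun S hS => ?_⟩
      · split_ifs
        · exact Finsupp.single_mem_supported _ _ fun w hw => hU w (List.mem_cons_of_mem _ hw)
        · exact zero_mem _
      · by_cases h : z = y <;> simp [fockField_cons, h]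
  | zero => exact ⟨0, zero_mem _, by simp⟩
  | add u v _ _ h1 h2 =>
    obtain ⟨u', hu', hu''⟩ := h1
    obtain ⟨v', hv', hv''⟩ := h2
    exact ⟨u' + v', add_mem hu' hv', fun S hS => by simp [hu'' S hS, hv'' S hS]⟩
  | smul c u _ h =>
    obtain ⟨u', hu', hu''⟩ := h
    exact ⟨c • u', Submodule.smul_mem _ _ hu', fun S hS => by simp [hu'' S hS]⟩

/-- The algebra generated by the fields of colour `i`. -/
def colourAlgebra (i : ι) : Subalgebra ℂ (FockSpace Y →L[ℂ] FockSpace Y) :=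
  Algebra.adjoin ℂ {a | ∃ y, p y = i ∧ a = fockField y}

theorem colourAlgebra_colour {i : ι} {a : FockSpace Y →L[ℂ] FockSpace Y}
    (ha : a ∈ colourAlgebra p i) : ∀ u ∈ colourWords p i,
    ∃ u' ∈ colourWords p i, ∀ S : List Y, (∀ z ∈ S.head?, p z ≠ i) →
      a (Finsupp.linearCombination ℂ (fun U => fockVec (U ++ S)) u) =
        Finsupp.linearCombination ℂ (fun U => fockVec (U ++ S)) u' := by
  induction ha using Algebra.adjoin_induction with
  | mem a ha =>
    obtain ⟨y, rfl, rfl⟩ := ha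
    exact fun u hu => fockField_colour p y hu
  | algebraMap r =>
    exact fun u hu => ⟨r • u, Submodule.smul_mem _ _ hu, fun S _ => by
      simp [Algebra.algebraMap_eq_smul_one]⟩
  | add a b _ _ h1 h2 =>
    intro u hu
    obtain ⟨u', hu', hu''⟩ := h1 u hu
    obtain ⟨v', hv', hv''⟩ := h2 u hu
    exact ⟨u' + v', add_mem hu' hv', fun S hS => by simp [hu'' S hS, hv'' S hS]⟩
  | mul a b _ _ h1 h2 =>
    intro u hu
    obtain ⟨u', hu', hu''⟩ := h2 u hu
    obtain ⟨v', hv', hv''⟩ := h1 u' hu'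
    exact ⟨v', hv', fun S hS => by
      rw [fock_mul_apply, hu'' S hS, hv'' S hS]⟩

/-- The same `u` describes the action of `a` on all admissible `S`. At `S = []` its coefficient at
the empty word is the vacuum expectation, so for centred `a` only nonempty words are put before `S`.
-/
theorem colourAlgebra_fockVec_mem {i : ι} {a : FockSpace Y →L[ℂ] FockSpace Y}
    (ha : a ∈ colourAlgebra p i) (h0 : vacuum Y a = 0) {S : List Y}
    (hS : ∀ z ∈ S.head?, p z ≠ i) : a (fockVec S) ∈ colourVecs p i := by
  obtain ⟨u, hu, hu'⟩ := colourAlgebra_colour p ha (Finsupp.single [] 1)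
    (Finsupp.single_mem_supported _ _ (by simp))
  simp only [Finsupp.linearCombination_single, one_smul, List.nil_append] at hu'
  have hu0 : u [] = 0 := by
    rw [vacuum_apply, hu' [] (by simp), Finsupp.linearCombination_apply, Finsupp.sum,
      lp.coeFn_sum, Finset.sum_apply] at h0
    simpa [fockVec_apply] using h0
  rw [hu' S hS, Finsupp.linearCombination_apply]
  refine Submodule.sum_mem _ fun U hU => Submodule.smul_mem _ _ (Submodule.subset_span ?_)
  cases U with
  | nil => exact absurd hu0 (Finsupp.mem_support_iff.1 hU)
  | cons y U => exact ⟨y, U ++ S, hu hU y (by simp), rfl⟩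

theorem colourAlgebra_mem_colourVecs {i j : ι} (hij : i ≠ j) {a : FockSpace Y →L[ℂ] FockSpace Y}
    (ha : a ∈ colourAlgebra p i) (h0 : vacuum Y a = 0) {v : FockSpace Y}
    (hv : v ∈ colourVecs p j) : a v ∈ colourVecs p i := by
  induction hv using Submodule.span_induction with
  | mem v hv =>
    obtain ⟨y, T, rfl, rfl⟩ := hv
    exact colourAlgebra_fockVec_mem p ha h0 (by simpa using hij.symm)
  | zero => simp
  | add u v _ _ h1 h2 => rw [map_add]; exact add_mem h1 h2
  | smul c u _ h => rw [map_smul]; exact Submodule.smul_mem _ _ h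

theorem apply_nil_of_mem_colourVecs {i : ι} {v : FockSpace Y} (hv : v ∈ colourVecs p i) :
    v [] = 0 := by
  induction hv using Submodule.span_induction with
  | mem v hv =>
    obtain ⟨y, T, -, rfl⟩ := hv
    simp [fockVec_apply]
  | zero => simp
  | add u v _ _ h1 h2 => simp [h1, h2]
  | smul c u _ h => simp [h]

/-- Applied from the right, each centred factor puts nonempty words of its own colour in front, so
the vacuum is never reached again. -/
theorem freeSubalgebras_colourAlgebra : FreeSubalgebras (vacuum Y) (colourAlgebra p) := by
  intro n i a hi ha h0
  rw [vacuum_apply]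
  refine apply_nil_of_mem_colourVecs p (i := i 0) ?_
  induction n with
  | zero =>
    simpa using colourAlgebra_fockVec_mem p (ha 0) (h0 0) (S := []) (by simp)
  | succ n ih =>
    rw [List.ofFn_succ, List.prod_cons, fock_mul_apply]
    exact colourAlgebra_mem_colourVecs p (hi 0) (ha 0) (h0 0)
      (ih (fun k => i k.succ) (fun k => a k.succ) (fun k => hi k.succ) (fun k => ha _)
        fun k => h0 _)

end Fock

section FreeSubalgebras

theorem FreeSubalgebras.mono {A ι κ : Type*} [Ring A] [Algebra ℂ A] {φ : A →ₗ[ℂ] ℂ}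
    {S : ι → Subalgebra ℂ A} (h : FreeSubalgebras φ S) {T : κ → Subalgebra ℂ A} {f : κ → ι}
    (hf : Function.Injective f) (hT : ∀ k, T k ≤ S (f k)) : FreeSubalgebras φ T :=
  fun n i a hi ha h0 => h n (f ∘ i) a (fun k => hf.ne (hi k)) (fun k => hT _ (ha k)) h0

end FreeSubalgebras

/-! ### Circular operators on the Fock space and their noncrossing moments. -/

section FockCircular

variable {ι : Type*} [DecidableEq ι]

/-- Circular operators on the Fock space. -/
def fockCircular (i : ι) : FockSpace (ι × Fin 2) →L[ℂ] FockSpace (ι × Fin 2) :=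
  (((Real.sqrt 2)⁻¹ : ℝ) : ℂ) • (fockField (i, 0) + Complex.I • fockField (i, 1))

theorem isFreeCircularFamily_fockCircular :
    IsFreeCircularFamily (vacuum (ι × Fin 2)) (fockCircular (ι := ι)) where
  state := isState_vacuum
  circular i := by
    refine ⟨fockField (i, 0), fockField (i, 1), isSemicircular_fockField _,
      isSemicircular_fockField _, ?_, rfl⟩
    refine FreeSubalgebras.mono (freeSubalgebras_colourAlgebra id) (f := fun k => (i, k))
      (fun a b h => congrArg Prod.snd h) fun k => Algebra.adjoin_mono ?_
    fin_cases k <;> simp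
  free := by
    refine FreeSubalgebras.mono (freeSubalgebras_colourAlgebra Prod.fst) (f := id)
      Function.injective_id fun i => Algebra.adjoin_le ?_
    have h : ∀ k, fockField (i, k) ∈ colourAlgebra (Y := ι × Fin 2) Prod.fst i := fun k =>
      Algebra.subset_adjoin ⟨(i, k), rfl, rfl⟩
    rintro _ (rfl | rfl)
    · exact Subalgebra.smul_mem _ (add_mem (h 0) (Subalgebra.smul_mem _ (h 1) _)) _
    · simp only [fockCircular, star_smul, star_add, (isSelfAdjoint_fockField _).star_eq]
      exact Subalgebra.smul_mem _ (add_mem (h 0) (Subalgebra.smul_mem _ (h 1) _)) _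

/-- The creation part of the circular operators and of their adjoints. -/
def circularCreate : ι ⊕ ι → (FockSpace (ι × Fin 2) →L[ℂ] FockSpace (ι × Fin 2))
  | .inl i => (((Real.sqrt 2)⁻¹ : ℝ) : ℂ) • (create (i, 0) + Complex.I • create (i, 1))
  | .inr i => (((Real.sqrt 2)⁻¹ : ℝ) : ℂ) • (create (i, 0) - Complex.I • create (i, 1))

theorem withAdjoints_fockCircular (x : ι ⊕ ι) :
    withAdjoints fockCircular x = circularCreate x + star (circularCreate x.swap) := by
  rcases x with i | i
  · simp only [withAdjoints, Sum.elim_inl, fockCircular, fockField, circularCreate, Sum.swap_inl,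
      star_smul, star_sub]
    simp [smul_add]
    abel
  · simp only [withAdjoints, Sum.elim_inr, fockCircular, fockField, circularCreate, Sum.swap_inr,
      star_smul, star_add]
    simp [smul_add, smul_sub]
    abel

/-- The vectors `(e₀ ± √-1 e₁) / √2` created by the letters `inl i` and `inr i` are again
orthonormal. -/
theorem star_circularCreate_mul (x y : ι ⊕ ι) :
    star (circularCreate x) * circularCreate y = if y = x then 1 else 0 := by
  have hs : (((Real.sqrt 2)⁻¹ : ℝ) : ℂ) * (((Real.sqrt 2)⁻¹ : ℝ) : ℂ) = 1 / 2 := by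
    rw [← Complex.ofReal_mul, ← mul_inv, Real.mul_self_sqrt zero_le_two]
    norm_num
  have key : ∀ (i k : ι) (α β : ℂ),
      star ((((Real.sqrt 2)⁻¹ : ℝ) : ℂ) • (create (i, (0 : Fin 2)) + α • create (i, 1))) *
        ((((Real.sqrt 2)⁻¹ : ℝ) : ℂ) • (create (k, 0) + β • create (k, 1))) =
        if k = i then ((1 / 2 : ℂ) * (1 + star α * β)) • 1 else 0 := by
    intro i k α β
    have h0 : star (((Real.sqrt 2)⁻¹ : ℝ) : ℂ) = (((Real.sqrt 2)⁻¹ : ℝ) : ℂ) :=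
      Complex.conj_ofReal _
    rw [star_smul, h0, smul_mul_smul_comm, hs]
    simp only [star_smul, star_add, add_mul, mul_add, smul_mul_assoc,
      mul_smul_comm, star_create_mul_create, Prod.mk.injEq]
    by_cases h : k = i
    · simp [h]
      module
    · simp [h, Ne.symm h]
  have e0 : ∀ i, circularCreate (.inl i : ι ⊕ ι) =
      (((Real.sqrt 2)⁻¹ : ℝ) : ℂ) • (create (i, 0) + Complex.I • create (i, 1)) := fun i => rfl
  have e1 : ∀ i, circularCreate (.inr i : ι ⊕ ι) =
      (((Real.sqrt 2)⁻¹ : ℝ) : ℂ) • (create (i, 0) + (-Complex.I) • create (i, 1)) := by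
    intro i; rw [circularCreate, neg_smul, sub_eq_add_neg]
  have hI : star Complex.I = -Complex.I := Complex.conj_I
  rcases x with i | i <;> rcases y with k | k <;> simp only [e0, e1, key] <;>
    by_cases h : k = i <;> simp [h] <;> norm_num

theorem star_circularCreate_fockVec_nil (x : ι ⊕ ι) :
    star (circularCreate x) (fockVec []) = 0 := by
  rcases x with i | i <;> simp [circularCreate, star_create_fockVec_nil]

/-- The vectors obtained from the vacuum by creation of a list of circular letters. -/
def circularVec (T : List (ι ⊕ ι)) : FockSpace (ι × Fin 2) :=
  (T.map circularCreate).prod (fockVec [])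

theorem withAdjoints_fockCircular_circularVec_nil (x : ι ⊕ ι) :
    withAdjoints fockCircular x (circularVec []) = circularVec [x] := by
  simp [withAdjoints_fockCircular, circularVec, star_circularCreate_fockVec_nil]

theorem withAdjoints_fockCircular_circularVec_cons (x y : ι ⊕ ι) (T : List (ι ⊕ ι)) :
    withAdjoints fockCircular x (circularVec (y :: T)) =
      circularVec (x :: y :: T) + if y = x.swap then circularVec T else 0 := by
  have h := congrArg (fun a => a (circularVec T)) (star_circularCreate_mul x.swap y)
  simp only [fock_mul_apply] at h
  rw [withAdjoints_fockCircular, add_apply]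
  congr 1
  refine Eq.trans ?_ (h.trans ?_)
  · simp [circularVec]
  · split_ifs <;> simp

theorem circularVec_apply_nil (T : List (ι ⊕ ι)) :
    circularVec T [] = if T = [] then 1 else 0 := by
  cases T with
  | nil => simp [circularVec, fockVec_apply]
  | cons x T =>
    simp only [reduceCtorEq, if_false, circularVec, List.map_cons, List.prod_cons,
      fock_mul_apply]
    rw [← inner_fockVec, ← ContinuousLinearMap.adjoint_inner_left,
      ← ContinuousLinearMap.star_eq_adjoint, star_circularCreate_fockVec_nil, inner_zero_left]

/-- The list `T` plays the role of the open letters: creation opens `x`, and annihilation closes the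
head if it is `x.swap`. -/
theorem word_circularVec_apply_nil (w T : List (ι ⊕ ι)) :
    (w.reverse.map (withAdjoints fockCircular)).prod (circularVec T) [] = noncrossingSum w T := by
  induction w generalizing T with
  | nil => simp [circularVec_apply_nil, noncrossingSum, apply_ite]
  | cons x w ih =>
    simp only [List.reverse_cons, List.map_append, List.prod_append, List.map_cons, List.map_nil,
      List.prod_cons, List.prod_nil, mul_one, fock_mul_apply]
    cases T with
    | nil => rw [withAdjoints_fockCircular_circularVec_nil, ih, noncrossingSum]
    | cons y T =>
      rw [withAdjoints_fockCircular_circularVec_cons, map_add, noncrossingSum]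
      split_ifs with h
      · rw [lp.coeFn_add, Pi.add_apply, ih, ih, Complex.ofReal_add]
      · rw [map_zero, add_zero, add_zero, ih]

theorem vacuum_word (w : List (ι ⊕ ι)) :
    vacuum (ι × Fin 2) (w.map (withAdjoints fockCircular)).prod = noncrossingSum w.reverse [] := by
  rw [← word_circularVec_apply_nil, List.reverse_reverse, vacuum_apply]
  simp [circularVec]

end FockCircular

/-! ### Freeness determines the joint distribution. -/

section Uniqueness

variable {Y ι A B : Type*} [Ring A] [Algebra ℂ A] [Ring B] [Algebra ℂ B]

/-- The polynomials in the variables of colour `i`. -/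
def colourPolys (p : Y → ι) (i : ι) : Subalgebra ℂ (FreeAlgebra ℂ Y) :=
  Algebra.adjoin ℂ {Q | ∃ y, p y = i ∧ Q = FreeAlgebra.ι ℂ y}

/-- The alternating products of polynomials in variables of one colour, centred with respect to
the functional `φ`. -/
def alternatingWords (p : Y → ι) (φ : FreeAlgebra ℂ Y →ₗ[ℂ] ℂ) : Set (FreeAlgebra ℂ Y) :=
  {x | ∃ (n : ℕ) (i : Fin (n + 1) → ι) (a : Fin (n + 1) → FreeAlgebra ℂ Y),
    (∀ k : Fin n, i k.castSucc ≠ i k.succ) ∧ (∀ k, a k ∈ colourPolys p (i k)) ∧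
      (∀ k, φ (a k) = 0) ∧ x = (List.ofFn a).prod}

/-- After merging `f` with the first factor if the colours agree, the new first factor is split into
its centred part and a scalar; both resulting terms lie in the span. -/
theorem mul_mem_span_alternatingWords (p : Y → ι) {φ : FreeAlgebra ℂ Y →ₗ[ℂ] ℂ} (hφ : φ 1 = 1)
    {j : ι} {f w : FreeAlgebra ℂ Y} (hf : f ∈ colourPolys p j)
    (hw : w ∈ Submodule.span ℂ (insert 1 (alternatingWords p φ))) :
    f * w ∈ Submodule.span ℂ (insert 1 (alternatingWords p φ)) := by
  set W := Submodule.span ℂ (insert 1 (alternatingWords p φ)) with hWdef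
  have h1 : (1 : FreeAlgebra ℂ Y) ∈ W := Submodule.subset_span (Set.mem_insert _ _)
  have hcentre : ∀ g ∈ colourPolys p j, g - φ g • 1 ∈ colourPolys p j ∧ φ (g - φ g • 1) = 0 :=
    fun g hg => ⟨sub_mem hg (Subalgebra.smul_mem _ (one_mem _) _), by simp [hφ]⟩
  have hsplit : ∀ g x : FreeAlgebra ℂ Y, x ∈ W → (g - φ g • 1) * x ∈ W → g * x ∈ W := by
    intro g x hx hgx
    have : g * x = (g - φ g • 1) * x + φ g • x := by simp [sub_mul]
    rw [this]
    exact add_mem hgx (Submodule.smul_mem _ _ hx)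
  induction hw using Submodule.span_induction with
  | mem w hw =>
    rcases hw with rfl | ⟨n, i, a, hi, ha, h0, rfl⟩
    · refine hsplit f 1 h1 (Submodule.subset_span (Set.mem_insert_of_mem _ ?_))
      exact ⟨0, fun _ => j, fun _ => f - φ f • 1, fun k => k.elim0,
        fun _ => (hcentre f hf).1, fun _ => (hcentre f hf).2, by simp⟩
    · have hmem : (List.ofFn a).prod ∈ W :=
        Submodule.subset_span (Set.mem_insert_of_mem _ ⟨n, i, a, hi, ha, h0, rfl⟩)
      by_cases hj : i 0 = j
      · rw [List.ofFn_succ, List.prod_cons, ← mul_assoc]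
        have hfa : f * a 0 ∈ colourPolys p j := mul_mem hf (hj ▸ ha 0)
        refine hsplit _ _ ?_ (Submodule.subset_span (Set.mem_insert_of_mem _ ?_))
        · cases n with
          | zero => simpa using h1
          | succ n =>
            exact Submodule.subset_span (Set.mem_insert_of_mem _ ⟨n, fun k => i k.succ,
              fun k => a k.succ, fun k => hi k.succ, fun k => ha _, fun k => h0 _, rfl⟩)
        · refine ⟨n, i, Fin.cons (f * a 0 - φ (f * a 0) • 1) fun k => a k.succ, hi, ?_, ?_, ?_⟩
          · intro k
            refine Fin.cases ?_ (fun k => ?_) k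
            · simpa [hj] using (hcentre _ hfa).1
            · simpa using ha k.succ
          · intro k
            refine Fin.cases ?_ (fun k => ?_) k
            · simpa using (hcentre _ hfa).2
            · simpa using h0 k.succ
          · simp [List.ofFn_succ]
      · refine hsplit f _ hmem (Submodule.subset_span (Set.mem_insert_of_mem _ ?_))
        refine ⟨n + 1, Fin.cons j i, Fin.cons (f - φ f • 1) a, ?_, ?_, ?_, ?_⟩
        · intro k
          refine Fin.cases ?_ (fun k => ?_) k
          · simpa using Ne.symm hj
          · simpa using hi k
        · intro k
          refine Fin.cases ?_ (fun k => ?_) k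
          · simpa using (hcentre _ hf).1
          · simpa using ha k
        · intro k
          refine Fin.cases ?_ (fun k => ?_) k
          · simpa using (hcentre _ hf).2
          · simpa using h0 k
        · rw [List.ofFn_succ]; simp
  | zero => simp
  | add u v _ _ hu hv => rw [mul_add]; exact add_mem hu hv
  | smul c u _ hu => rw [mul_smul_comm]; exact Submodule.smul_mem _ _ hu

theorem span_alternatingWords (p : Y → ι) {φ : FreeAlgebra ℂ Y →ₗ[ℂ] ℂ} (hφ : φ 1 = 1)
    (Q : FreeAlgebra ℂ Y) : Q ∈ Submodule.span ℂ (insert 1 (alternatingWords p φ)) := by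
  have key : ∀ w ∈ Submodule.span ℂ (insert 1 (alternatingWords p φ)),
      Q * w ∈ Submodule.span ℂ (insert 1 (alternatingWords p φ)) := by
    induction Q using FreeAlgebra.induction with
    | grade0 r =>
      intro w hw
      rw [← Algebra.smul_def]
      exact Submodule.smul_mem _ _ hw
    | grade1 y =>
      exact fun w hw => mul_mem_span_alternatingWords p hφ
        (Algebra.subset_adjoin ⟨y, rfl, rfl⟩ : _ ∈ colourPolys p (p y)) hw
    | mul a b ha hb => exact fun w hw => by rw [mul_assoc]; exact ha _ (hb _ hw)
    | add a b ha hb => exact fun w hw => by rw [add_mul]; exact add_mem (ha _ hw) (hb _ hw)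
  simpa using key 1 (Submodule.subset_span (Set.mem_insert _ _))

/-- The joint distribution of free families is determined by the distributions of the families. -/
theorem distribution_eq_of_free (p : Y → ι) {φ : A →ₗ[ℂ] ℂ} {ψ : B →ₗ[ℂ] ℂ} (hφ : φ 1 = 1)
    (hψ : ψ 1 = 1) {S : ι → Subalgebra ℂ A} {T : ι → Subalgebra ℂ B} (hS : FreeSubalgebras φ S)
    (hT : FreeSubalgebras ψ T) (α : FreeAlgebra ℂ Y →ₐ[ℂ] A) (β : FreeAlgebra ℂ Y →ₐ[ℂ] B)
    (hα : ∀ y, α (FreeAlgebra.ι ℂ y) ∈ S (p y)) (hβ : ∀ y, β (FreeAlgebra.ι ℂ y) ∈ T (p y))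
    (h : ∀ i, ∀ Q ∈ colourPolys p i, φ (α Q) = ψ (β Q)) (Q : FreeAlgebra ℂ Y) :
    φ (α Q) = ψ (β Q) := by
  have hα' : ∀ i, ∀ Q ∈ colourPolys p i, α Q ∈ S i := fun i => by
    change colourPolys p i ≤ (S i).comap α
    refine Algebra.adjoin_le ?_
    rintro _ ⟨y, rfl, rfl⟩
    exact hα y
  have hβ' : ∀ i, ∀ Q ∈ colourPolys p i, β Q ∈ T i := fun i => by
    change colourPolys p i ≤ (T i).comap β
    refine Algebra.adjoin_le ?_
    rintro _ ⟨y, rfl, rfl⟩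
    exact hβ y
  -- Factors centred for `φ ∘ α` are centred for `ψ ∘ β` as well, by `h`; thus both functionals
  -- vanish on alternating words.
  have hQ := span_alternatingWords p (φ := φ ∘ₗ α.toLinearMap) (by simp [hφ]) Q
  induction hQ using Submodule.span_induction with
  | mem w hw =>
    rcases hw with rfl | ⟨n, i, a, hi, ha, h0, rfl⟩
    · simp [hφ, hψ]
    · have h0' : ∀ k, φ (α (a k)) = 0 := h0
      rw [map_list_prod α, map_list_prod β, List.map_ofFn, List.map_ofFn,
        hS n i (α ∘ a) hi (fun k => hα' _ _ (ha k)) h0',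
        hT n i (β ∘ a) hi (fun k => hβ' _ _ (ha k)) fun k => (h _ _ (ha k)).symm.trans (h0' k)]
  | zero => simp
  | add u v _ _ hu hv => simp only [map_add, hu, hv]
  | smul c u _ hu => simp only [map_smul, hu]

end Uniqueness

/-! ### All free circular families have the same ⋆-moments. -/

section Circular

variable {ι A B : Type*} [CStarAlgebra A] [CStarAlgebra B]

theorem RandomConvolution.IsSemicircular.moment_eq {φ : A →ₗ[ℂ] ℂ} {ψ : B →ₗ[ℂ] ℂ} {a : A} {b : B}
    (ha : IsSemicircular φ a) (hb : IsSemicircular ψ b) (n : ℕ) : φ (a ^ n) = ψ (b ^ n) := by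
  obtain ⟨k, rfl | rfl⟩ := Nat.even_or_odd' n
  · rw [ha.even_moment, hb.even_moment]
  · rw [ha.odd_moment, hb.odd_moment]

/-- All pairs of free semicircular elements have the same joint distribution. -/
theorem distribution_eq_of_free_semicircular {φ : A →ₗ[ℂ] ℂ} {ψ : B →ₗ[ℂ] ℂ} (hφ : φ 1 = 1)
    (hψ : ψ 1 = 1) {a : Fin 2 → A} {b : Fin 2 → B} (ha : ∀ k, IsSemicircular φ (a k))
    (hb : ∀ k, IsSemicircular ψ (b k)) (hfa : FreeSets φ fun k => {a k})
    (hfb : FreeSets ψ fun k => {b k}) (Q : FreeAlgebra ℂ (Fin 2)) :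
    φ (FreeAlgebra.lift ℂ a Q) = ψ (FreeAlgebra.lift ℂ b Q) := by
  refine distribution_eq_of_free id hφ hψ hfa hfb _ _
    (fun k => by simp)
    (fun k => by simp) (fun i Q hQ => ?_) Q
  have hQ' : Q ∈ Algebra.adjoin ℂ {FreeAlgebra.ι ℂ i} := by
    refine Algebra.adjoin_mono ?_ hQ
    rintro _ ⟨y, rfl, rfl⟩
    rfl
  rw [Algebra.adjoin_singleton_eq_range_aeval] at hQ'
  obtain ⟨q, rfl⟩ := hQ'
  simp only [AlgHom.toRingHom_eq_coe, RingHom.coe_coe, ← Polynomial.aeval_algHom_apply,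
    FreeAlgebra.lift_ι_apply]
  clear hQ
  induction q using Polynomial.induction_on' with
  | add p q hp hq => simp only [map_add, hp, hq]
  | monomial n r =>
    simp only [Polynomial.aeval_monomial, ← Algebra.smul_def, map_smul, (ha i).moment_eq (hb i)]

/-- All free circular families have the same joint ⋆-distribution. -/
theorem ncDistribution_eq_of_isFreeCircularFamily {φ : A →ₗ[ℂ] ℂ} {ψ : B →ₗ[ℂ] ℂ} {c : ι → A}
    {d : ι → B} (hc : IsFreeCircularFamily φ c) (hd : IsFreeCircularFamily ψ d)
    (Q : FreeAlgebra ℂ (ι ⊕ ι)) :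
    ncDistribution φ (withAdjoints c) Q = ncDistribution ψ (withAdjoints d) Q := by
  refine distribution_eq_of_free (Sum.elim id id) hc.state.map_one hd.state.map_one hc.free hd.free
    _ _ ?_ ?_ (fun i Q hQ => ?_) Q
  · rintro (i | i) <;> exact Algebra.subset_adjoin (by simp [withAdjoints])
  · rintro (i | i) <;> exact Algebra.subset_adjoin (by simp [withAdjoints])
  obtain ⟨a₀, a₁, ha₀, ha₁, hfa, hca⟩ := hc.circular i
  obtain ⟨b₀, b₁, hb₀, hb₁, hfb, hdb⟩ := hd.circular i
  have hstar : star (((Real.sqrt 2)⁻¹ : ℝ) : ℂ) = (((Real.sqrt 2)⁻¹ : ℝ) : ℂ) :=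
    Complex.conj_ofReal _
  have hI : star Complex.I = -Complex.I := Complex.conj_I
  -- Within one colour, both families are rewritten by the same polynomial `Q₀` in their
  -- semicircular parts, which reduces the claim to free semicircular pairs.
  obtain ⟨Q₀, h1, h2⟩ : ∃ Q₀ : FreeAlgebra ℂ (Fin 2),
      FreeAlgebra.lift ℂ (withAdjoints c) Q = FreeAlgebra.lift ℂ ![a₀, a₁] Q₀ ∧
      FreeAlgebra.lift ℂ (withAdjoints d) Q = FreeAlgebra.lift ℂ ![b₀, b₁] Q₀ := by
    induction hQ using Algebra.adjoin_induction with
    | mem Q hQ =>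
      obtain ⟨y, hy, rfl⟩ := hQ
      rcases y with k | k
      · obtain rfl : k = i := hy
        refine ⟨(((Real.sqrt 2)⁻¹ : ℝ) : ℂ) •
          (FreeAlgebra.ι ℂ 0 + Complex.I • FreeAlgebra.ι ℂ 1), ?_, ?_⟩
        · simp [withAdjoints, hca]
        · simp [withAdjoints, hdb]
      · obtain rfl : k = i := hy
        refine ⟨(((Real.sqrt 2)⁻¹ : ℝ) : ℂ) •
          (FreeAlgebra.ι ℂ 0 + (-Complex.I) • FreeAlgebra.ι ℂ 1), ?_, ?_⟩
        · rw [FreeAlgebra.lift_ι_apply, withAdjoints, Sum.elim_inr, hca, star_smul, star_add,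
            star_smul, hstar, hI, ha₀.selfAdjoint.star_eq, ha₁.selfAdjoint.star_eq]
          simp
        · rw [FreeAlgebra.lift_ι_apply, withAdjoints, Sum.elim_inr, hdb, star_smul, star_add,
            star_smul, hstar, hI, hb₀.selfAdjoint.star_eq, hb₁.selfAdjoint.star_eq]
          simp
    | algebraMap r => exact ⟨algebraMap _ _ r, by simp, by simp⟩
    | add P Q _ _ hP hQ =>
      obtain ⟨P', hP1, hP2⟩ := hP
      obtain ⟨Q', hQ1, hQ2⟩ := hQ
      exact ⟨P' + Q', by simp only [map_add, hP1, hQ1], by simp only [map_add, hP2, hQ2]⟩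
    | mul P Q _ _ hP hQ =>
      obtain ⟨P', hP1, hP2⟩ := hP
      obtain ⟨Q', hQ1, hQ2⟩ := hQ
      exact ⟨P' * Q', by simp only [map_mul, hP1, hQ1], by simp only [map_mul, hP2, hQ2]⟩
  rw [h1, h2]
  refine distribution_eq_of_free_semicircular hc.state.map_one hd.state.map_one ?_ ?_ ?_ ?_ Q₀
  · intro k; fin_cases k <;> assumption
  · intro k; fin_cases k <;> assumption
  · convert hfa using 1; ext k; fin_cases k <;> rfl
  · convert hfb using 1; ext k; fin_cases k <;> rfl

theorem ncDistribution_word [DecidableEq ι] {φ : A →ₗ[ℂ] ℂ} {c : ι → A}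
    (hc : IsFreeCircularFamily φ c) (w : List (ι ⊕ ι)) :
    ncDistribution φ (withAdjoints c) (w.map (FreeAlgebra.ι ℂ)).prod =
      noncrossingSum w.reverse [] := by
  rw [ncDistribution_eq_of_isFreeCircularFamily hc isFreeCircularFamily_fockCircular, ← vacuum_word,
    ncDistribution, map_list_prod, List.map_map]
  congr 3
  ext1 x
  simp

end Circular

/-! ### Reduction to words, and the limit. -/

section Convergence

theorem mem_span_words {Y : Type*} (Q : FreeAlgebra ℂ Y) :
    Q ∈ Submodule.span ℂ (Set.range fun w : List Y => (w.map (FreeAlgebra.ι ℂ)).prod) := by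
  have h : Q ∈ Algebra.adjoin ℂ (Set.range (FreeAlgebra.ι ℂ : Y → FreeAlgebra ℂ Y)) := by
    rw [FreeAlgebra.adjoin_range_ι]; trivial
  rw [← Subalgebra.mem_toSubmodule, Algebra.adjoin_eq_span] at h
  refine Submodule.span_mono ?_ h
  intro x hx
  obtain ⟨l, hl, rfl⟩ := Submonoid.exists_list_of_mem_closure hx
  have : l ∈ Set.range (List.map (FreeAlgebra.ι ℂ : Y → FreeAlgebra ℂ Y)) := by
    rw [Set.range_list_map]; exact hl
  obtain ⟨w, rfl⟩ := this
  exact ⟨w, rfl⟩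

theorem ncDistribution_meanTrace_word {ι G Ω : Type*} [Group G] [Fintype G] [DecidableEq G]
    [MeasurableSpace Ω] [Fintype ι] [DecidableEq ι] {P : Measure Ω}
    [IsProbabilityMeasure P]
    {X : ι → G → Ω → ℂ} (hX : ∀ i g, IsStdComplexGaussian (X i g) P)
    (hind : iIndepFun (fun p : ι × G => X p.1 p.2) P) (w : List (ι ⊕ ι)) :
    ncDistribution (meanTrace P) (withAdjoints fun i => normConv (X i))
      (w.map (FreeAlgebra.ι ℂ)).prod = (pairingSum w.reverse [] (1 : G) : ℝ) := by
  rw [← meanTrace_word hX hind, ncDistribution]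
  congr 1
  ext1 ω
  rw [map_list_prod, List.map_map, Pi.list_prod_apply, List.map_map]
  congr 2
  ext1 x
  simp

theorem abs_pairingSum_sub_noncrossingSum_le {ι G : Type*} [DecidableEq ι] [Group G] [Fintype G]
    [DecidableEq G] (w : List (ι ⊕ ι)) :
    |pairingSum w [] (1 : G) - noncrossingSum w []| ≤ pairingBound w.length 0 * commRatio G := by
  simpa [letterExpect, letterProd] using abs_letterExpect_pairingSum_sub_le (G := G) w []

end Convergence

end

theorem proposition4 {m : ℕ} (G : ℕ → Type*) [∀ N, Group (G N)] [∀ N, Fintype (G N)]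
    [∀ N, DecidableEq (G N)]
    (hcard : Tendsto (fun N => Fintype.card (G N)) atTop atTop)
    (hμ : WeaklyConverges (fun N => plancherelDim (G N))
      (Measure.dirac (OnePoint.infty : OnePoint ℕ+)))
    (Ω : ℕ → Type*) [∀ N, MeasurableSpace (Ω N)]
    (P : ∀ N, Measure (Ω N)) [∀ N, IsProbabilityMeasure (P N)]
    (X : ∀ N, Fin m → G N → Ω N → ℂ)
    (hgauss : ∀ N i g, IsStdComplexGaussian (X N i g) (P N))
    (hindep : ∀ N, iIndepFun (fun p : Fin m × G N => X N p.1 p.2) (P N)) :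
    -- all the moments of the random matrices are well defined
    (∀ (N : ℕ) (Q : FreeAlgebra ℂ (Fin m ⊕ Fin m)),
      Integrable (fun ω => (FreeAlgebra.lift ℂ
        (withAdjoints fun i => normConv (X N i)) Q ω).trace) (P N)) ∧
    -- a free circular family exists
    (∃ (A : Type) (_ : CStarAlgebra A) (φ : A →ₗ[ℂ] ℂ) (c : Fin m → A),
      IsFreeCircularFamily φ c) ∧
    -- and the random matrices converge in ⋆-moments to every such family
    ∀ (A : Type*) [CStarAlgebra A] (φ : A →ₗ[ℂ] ℂ) (c : Fin m → A),
      IsFreeCircularFamily φ c →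
      ∀ Q : FreeAlgebra ℂ (Fin m ⊕ Fin m),
        Tendsto
          (fun N => ncDistribution (meanTrace (P N))
            (withAdjoints fun i => normConv (X N i)) Q)
          atTop (𝓝 (ncDistribution φ (withAdjoints c) Q)) := by
  have hint : ∀ (N : ℕ) (Q : FreeAlgebra ℂ (Fin m ⊕ Fin m)),
      Integrable (fun ω => (FreeAlgebra.lift ℂ
        (withAdjoints fun i => normConv (X N i)) Q ω).trace) (P N) :=
    fun N Q => integrable_trace_lift (hgauss N) Q
  refine ⟨hint, ⟨FockSpace (Fin m × Fin 2) →L[ℂ] FockSpace (Fin m × Fin 2), inferInstance, _, _,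
    isFreeCircularFamily_fockCircular⟩, fun A _ φ c hc Q => ?_⟩
  -- Both sides are linear in `Q`, on the left thanks to `hint`, so words suffice. For a word the
  -- error is at most a constant independent of `N` times `commRatio (G N)`.
  induction mem_span_words Q using Submodule.span_induction with
  | mem Q hQ =>
    obtain ⟨w, rfl⟩ := hQ
    simp only [ncDistribution_meanTrace_word (hgauss _) (hindep _), ncDistribution_word hc]
    refine (Complex.continuous_ofReal.tendsto _).comp ?_
    rw [tendsto_iff_norm_sub_tendsto_zero]
    refine squeeze_zero (fun N => norm_nonneg _)
      (fun N => abs_pairingSum_sub_noncrossingSum_le w.reverse) ?_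
    simpa using (tendsto_commRatio hμ).const_mul _
  | zero => simp [ncDistribution, meanTrace]
  | add Q R _ _ hQ hR =>
    convert hQ.add hR using 1
    · ext N
      simp only [ncDistribution, meanTrace, map_add, Pi.add_apply, Matrix.trace_add]
      rw [integral_add (hint N Q) (hint N R), mul_add]
    · simp [ncDistribution]
  | smul r Q _ hQ =>
    convert hQ.const_mul r using 1
    · ext N
      simp only [ncDistribution, meanTrace, map_smul, Pi.smul_apply, Matrix.trace_smul, smul_eq_mul]
      rw [integral_const_mul, mul_left_comm]
    · simp [ncDistribution]
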